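/- A $\mathbb{Z}$-VAS of dimension $d>0$ consists of a single control state $q$, a finite alphabet $\Sigma$, a set $\Delta\subseteq\{q\}\times\Sigma\times\{q\}$ of transitions, and for every letter $a\in\Sigma$ a translation $\tau(a)\colon\mathbb{Z}^d\to\mathbb{Z}^d$, $\vec v\mapsto \vec v+\vec b_a$, with $\vec b_a\in\mathbb{Z}^d$. For a transition $(q,a,q)\in\Delta$ and $\vec v\in\mathbb{Z}^d$ there is a step $q(\vec v)\to q(\tau(a)(\vec v))$; $\to^*$ is the reflexive transitive closure of $\to$, and $\mathit{reach}(\mathcal A,q(\vec v))=\{\vec v'\in\mathbb{Z}^d : q(\vec v)\to^*_{\mathcal A} q(\vec v')\}$. *Reachability for $\mathbb{Z}$-VAS:* given $d>0$, a $\mathbb{Z}$-VAS $\mathcal A$ of dimension $d$ with control state $q$, and $\vec v,\vec v'\in\mathbb{Z}^d$, does $q(\vec v)\to^*_{\mathcal A}q(\vec v')$ hold? *Inclusion for $\mathbb{Z}$-VAS:* given $d>0$, $\mathbb{Z}$-VAS $\mathcal A,\mathcal B$ of dimension $d$ with control states $q,p$, and $\vec v,\vec w\in\mathbb{Z}^d$,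 does $\mathit{reach}(\mathcal A,q(\vec v))\subseteq\mathit{reach}(\mathcal B,p(\vec w))$ hold? The dimension and the alphabet are part of the input; an instance is written down by listing its vectors entry by entry. **Theorem.** Both when the integers in the input are encoded in binary and already when they are encoded in unary, reachability for $\mathbb{Z}$-VAS is NP-hard and inclusion for $\mathbb{Z}$-VAS is NP-hard. Here NP-hard means that for every finite alphabet $\Gamma$ and every language $L\subseteq\Gamma^*$ in NP (accepted by a nondeterministic Turing machine in polynomial time) there is a function $f$ from $\Gamma^*$ to encoded instances, computable by a deterministic Turing machine in polynomial time, such that for all $w\in\Gamma^*$: $w\in L$ if and only if $f(w)$ is a yes-instance. -/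

import Mathlib

/-! ## Nondeterministic Turing machines and the class NP -/

/-- Head movements of a Turing machine. -/
inductive HeadMove where
  | left
  | stay
  | right

/-- The displacement of the head. -/
def HeadMove.toInt : HeadMove → ℤ
  | .left => -1
  | .stay => 0
  | .right => 1

/-- A nondeterministic Turing machine with one two-way infinite tape and input alphabet `Γ`. -/
structure NTM (Γ : Type) where
  /-- control states -/
  State : Type
  [finState : Finite State]
  /-- tape symbols -/
  Sym : Type
  [finSym : Finite Sym]
  /-- the blank tape symbol -/
  blank : Sym
  /-- input symbols are tape symbols different from the blank -/
  input : Γ → Sym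
  input_injective : Function.Injective input
  input_ne_blank : ∀ x, input x ≠ blank
  /-- the initial state -/
  start : State
  /-- the accepting states -/
  accept : Set State
  /-- the transition relation: the possible (new state, written symbol, head movement) -/
  next : State → Sym → Set (State × Sym × HeadMove)

namespace NTM

variable {Γ : Type}

/-- A configuration: control state, head position and tape contents. -/
structure Cfg (M : NTM Γ) where
  state : M.State
  head : ℤ
  tape : ℤ → M.Sym

/-- The tape carrying the word `w` in the cells `0, …, |w| - 1`, blank elsewhere. -/
def inputTape (M : NTM Γ) (w : List Γ) (i : ℤ) : M.Sym :=
  if 0 ≤ i then ((w[i.toNat]?).map M.input).getD M.blank else M.blank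

/-- The initial configuration on the input word `w`. -/
def init (M : NTM Γ) (w : List Γ) : M.Cfg := ⟨M.start, 0, M.inputTape w⟩

/-- One computation step. -/
def Step (M : NTM Γ) (c c' : M.Cfg) : Prop :=
  ∃ t ∈ M.next c.state (c.tape c.head),
    c'.state = t.1 ∧ c'.head = c.head + t.2.2.toInt ∧
      c'.tape = Function.update c.tape c.head t.2.1

/-- Some computation on `w` reaches an accepting state after at most `T` steps. -/
def AcceptsIn (M : NTM Γ) (w : List Γ) (T : ℕ) : Prop :=
  ∃ k ≤ T, ∃ c : ℕ → M.Cfg, c 0 = M.init w ∧ (∀ i < k, M.Step (c i) (c (i + 1))) ∧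
    (c k).state ∈ M.accept

end NTM

/-- The class NP: languages accepted by a nondeterministic Turing machine in polynomial time. -/
def InNP {Γ : Type} (L : Language Γ) : Prop :=
  ∃ (M : NTM Γ) (p : Polynomial ℕ), ∀ w : List Γ, w ∈ L ↔ M.AcceptsIn w (p.eval w.length)

/-- The decision problem `Yes` on instances of type `I`, written as words by means of `enc`, is
NP-hard: every language in NP (over any finite alphabet) is reducible to it by a function that a
deterministic multi-stack Turing machine computes in polynomial time. -/
def NPHard {I Δ : Type} (enc : Computability.Encoding I Δ) (Yes : I → Prop) : Prop :=
  ∀ (Γ : Type) [Finite Γ] (L : Language Γ), InNP L →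
    ∃ f : List Γ → I,
      Nonempty (Turing.TM2ComputableInPolyTime (id : List Γ → List Γ) enc.encode f) ∧
        ∀ w : List Γ, w ∈ L ↔ Yes (f w)

/-! ## Integer register machines and integer vector addition systems -/

/-- A dimension-`d` integer register machine over the set of matrices `𝔄`. The finite sets of
control states and of letters are initial segments of the natural numbers. -/
structure IntRegMachine (d : ℕ) (𝔄 : Set (Matrix (Fin d) (Fin d) ℤ)) where
  /-- there is at least one counter -/
  dim_pos : 0 < d
  /-- the control states are `Fin numStates` -/
  numStates : ℕ
  /-- the alphabet is `Fin numLetters` -/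
  numLetters : ℕ
  /-- the transitions -/
  trans : Finset (Fin numStates × Fin numLetters × Fin numStates)
  /-- the transformation of the counters by a letter -/
  τ : Fin numLetters → (Fin d → ℤ) → (Fin d → ℤ)
  /-- every letter acts by an affine transformation with matrix in `𝔄` -/
  affine : ∀ a, ∃ A ∈ 𝔄, ∃ b : Fin d → ℤ, ∀ v, τ a v = A.mulVec v + b

namespace IntRegMachine

variable {d : ℕ} {𝔄 : Set (Matrix (Fin d) (Fin d) ℤ)}

/-- Configurations `q(v)`. -/
abbrev Config (M : IntRegMachine d 𝔄) : Type := Fin M.numStates × (Fin d → ℤ)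

/-- The step relation reading the letter `a`. -/
def StepOn (M : IntRegMachine d 𝔄) (a : Fin M.numLetters) (c c' : M.Config) : Prop :=
  (c.1, a, c'.1) ∈ M.trans ∧ c'.2 = M.τ a c.2

/-- The existence of a run between two configurations. -/
def Reaches (M : IntRegMachine d 𝔄) : M.Config → M.Config → Prop :=
  Relation.ReflTransGen fun c c' => ∃ a, M.StepOn a c c'

/-- The reachability set: counter values reachable from `c`, in any control state. -/
def reach (M : IntRegMachine d 𝔄) (c : M.Config) : Set (Fin d → ℤ) :=
  {v | ∃ q, M.Reaches c (q, v)}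

end IntRegMachine

/-- An integer vector addition system with states: only the identity matrix is allowed. -/
abbrev ZVASS (d : ℕ) : Type := IntRegMachine d {1}

/-- An integer vector addition system: a `ZVASS` with a single control state. -/
structure ZVAS (d : ℕ) extends ZVASS d where
  single : numStates = 1

/-- Instances of the reachability problem. -/
structure ZVASReachInstance where
  d : ℕ
  machine : ZVAS d
  source : machine.Config
  target : machine.Config

/-- The reachability problem. -/
def ZVASReachability (I : ZVASReachInstance) : Prop :=
  I.machine.Reaches I.source I.target

/-- Instances of the inclusion problem. -/
structure ZVASInclusionInstance where
  d : ℕ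
  left : ZVAS d
  leftStart : left.Config
  right : ZVAS d
  rightStart : right.Config

/-- The inclusion problem. -/
def ZVASInclusion (I : ZVASInclusionInstance) : Prop :=
  I.left.reach I.leftStart ⊆ I.right.reach I.rightStart

/-! ## Writing instances as words -/

/-- The two ways of writing numbers. -/
inductive NumberCoding where
  | unary
  | binary

/-- The alphabet of the words that describe instances. -/
inductive CodeSym where
  | digit (b : Bool)
  | minus
  | comma
  | semicolon
  | bar
  deriving DecidableEq, Fintype

namespace NumberCoding

/-- The word of a natural number: `n` ones in unary, the binary digits of `n` (least significant
first, none for `0`) in binary. -/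
def encodeNat : NumberCoding → ℕ → List Bool
  | .unary => Computability.unaryEncodeNat
  | .binary => Computability.encodeNat

/-- The word of an integer: a sign if it is negative, and its absolute value. -/
def encodeInt (e : NumberCoding) (z : ℤ) : List CodeSym :=
  (if z < 0 then [CodeSym.minus] else []) ++ (e.encodeNat z.natAbs).map CodeSym.digit

/-- The word of a list of integers: every entry is followed by a comma. -/
def encodeRow (e : NumberCoding) (r : List ℤ) : List CodeSym :=
  r.flatMap fun z => e.encodeInt z ++ [CodeSym.comma]

/-- The word of a list of rows: every row is followed by a semicolon. -/
def encodeBlock (e : NumberCoding) (b : List (List ℤ)) : List CodeSym :=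
  b.flatMap fun r => e.encodeRow r ++ [CodeSym.semicolon]

/-- The word of a list of blocks: every block is followed by a bar. -/
def encodeBlocks (e : NumberCoding) (bs : List (List (List ℤ))) : List CodeSym :=
  bs.flatMap fun b => e.encodeBlock b ++ [CodeSym.bar]

theorem encodeNat_injective (e : NumberCoding) : Function.Injective e.encodeNat := by
  cases e
  · exact Function.LeftInverse.injective Computability.unary_decode_encode_nat
  · exact Function.LeftInverse.injective Computability.decode_encodeNat

theorem encodeInt_injective (e : NumberCoding) : Function.Injective e.encodeInt := by
  have hm : ∀ l l' : List Bool,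
      CodeSym.minus :: l.map CodeSym.digit ≠ l'.map CodeSym.digit := by
    intro l l' h
    cases l' <;> simp at h
  have hd : Function.Injective (List.map CodeSym.digit) :=
    List.map_injective_iff.2 fun a b h => by simpa using h
  intro y z h
  unfold encodeInt at h
  split_ifs at h with hy hz hz
  · have := e.encodeNat_injective (hd (List.append_cancel_left h))
    omega
  · exact absurd h (hm _ _)
  · exact absurd h.symm (hm _ _)
  · have := e.encodeNat_injective (hd (List.append_cancel_left h))
    omega

theorem flatMap_append_injective {α : Type} (g : α → List CodeSym) (t : CodeSym)
    (hg : Function.Injective g) (ht : ∀ x, t ∉ g x) :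
    Function.Injective fun l : List α => l.flatMap fun x => g x ++ [t] := by
  have key : ∀ u v r s : List CodeSym, t ∉ u → t ∉ v → u ++ t :: r = v ++ t :: s →
      u = v ∧ r = s := by
    intro u
    induction u with
    | nil =>
      intro v r s _ hv h
      cases v with
      | nil => simpa using h
      | cons b v => simp_all
    | cons a u ih =>
      intro v r s hu hv h
      cases v with
      | nil => simp_all
      | cons b v =>
        simp only [List.cons_append, List.cons.injEq] at h
        have := ih v r s (by simp_all) (by simp_all) h.2
        simp [h.1, this.1, this.2]
  intro l
  induction l with
  | nil => intro l' h; cases l' <;> simp_all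
  | cons x l ih =>
    intro l' h
    cases l' with
    | nil => simp at h
    | cons y l' =>
      simp only [List.flatMap_cons, List.append_assoc, List.singleton_append] at h
      obtain ⟨h1, h2⟩ := key _ _ _ _ (ht x) (ht y) h
      rw [hg h1, ih h2]

theorem encodeRow_injective (e : NumberCoding) : Function.Injective e.encodeRow :=
  flatMap_append_injective _ _ e.encodeInt_injective fun z => by
    unfold encodeInt; split_ifs <;> simp

theorem encodeBlock_injective (e : NumberCoding) : Function.Injective e.encodeBlock :=
  flatMap_append_injective _ _ e.encodeRow_injective fun r => by
    simp only [encodeRow, encodeInt]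
    simp only [List.mem_flatMap, not_exists, not_and]
    intro z _; split_ifs <;> simp

theorem encodeBlocks_injective (e : NumberCoding) : Function.Injective e.encodeBlocks :=
  flatMap_append_injective _ _ e.encodeBlock_injective fun b => by
    simp only [encodeBlock, encodeRow, encodeInt]
    simp only [List.mem_flatMap, not_exists, not_and, List.mem_append, not_or]
    intro r _
    refine ⟨fun z _ => ?_, by simp⟩
    split_ifs <;> simp

end NumberCoding

/-- The table of a `ZVAS`: one row per letter, which tells by `1` or `0` whether the self-loop with
that letter is a transition, and then lists the vector that the letter adds to the counters. -/
def ZVAS.rows {d : ℕ} (M : ZVAS d) : List (List ℤ) :=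
  List.ofFn fun a : Fin M.numLetters =>
    (if ∃ q q', (q, a, q') ∈ M.trans then 1 else 0) :: List.ofFn (M.τ a 0)

/-- The table of a reachability instance. Control states need not be named, there is only one. -/
def ZVASReachInstance.blocks (I : ZVASReachInstance) : List (List (List ℤ)) :=
  [I.machine.rows, [List.ofFn I.source.2, List.ofFn I.target.2]]

/-- The table of an inclusion instance. -/
def ZVASInclusionInstance.blocks (I : ZVASInclusionInstance) : List (List (List ℤ)) :=
  [I.left.rows, [List.ofFn I.leftStart.2], I.right.rows, [List.ofFn I.rightStart.2]]

theorem ZVAS.rows_injective {d : ℕ} : Function.Injective (ZVAS.rows (d := d)) := by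
  rintro ⟨⟨hd, n, m, D, τ, aff⟩, hn⟩ ⟨⟨hd', n', m', D', τ', aff'⟩, hn'⟩ h
  simp only at hn hn'
  subst hn hn'
  have hm : m = m' := by
    have := congrArg List.length h
    simpa [ZVAS.rows] using this
  subst hm
  have h2 := List.ofFn_injective h
  have hτ : τ = τ' := by
    funext a v
    have h3 : τ a 0 = τ' a 0 := List.ofFn_injective (List.cons.inj (congrFun h2 a)).2
    obtain ⟨A, rfl, b, hb⟩ := aff a
    obtain ⟨A', rfl, b', hb'⟩ := aff' a
    rw [hb, hb'] at h3
    rw [hb, hb']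
    simpa using h3
  subst hτ
  have hD : D = D' := by
    ext ⟨q, a, q'⟩
    have h3 := (List.cons.inj (congrFun h2 a)).1
    have e1 : ∀ E : Finset (Fin 1 × Fin m × Fin 1),
        (∃ p p', (p, a, p') ∈ E) ↔ (q, a, q') ∈ E := fun E =>
      ⟨fun ⟨p, p', hp⟩ => by rwa [Subsingleton.elim q p, Subsingleton.elim q' p'],
        fun hp => ⟨q, q', hp⟩⟩
    simp only [e1] at h3
    by_cases c1 : (q, a, q') ∈ D <;> by_cases c2 : (q, a, q') ∈ D' <;> simp_all
  subst hD
  rfl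

theorem ZVAS.config_ext {d : ℕ} (M : ZVAS d) {c c' : M.Config} (h : c.2 = c'.2) : c = c' := by
  have : Subsingleton (Fin M.numStates) := by rw [M.single]; infer_instance
  exact Prod.ext (Subsingleton.elim _ _) h

theorem ZVASReachInstance.blocks_injective : Function.Injective ZVASReachInstance.blocks := by
  rintro ⟨d, M, c, t⟩ ⟨d', M', c', t'⟩ h
  simp only [ZVASReachInstance.blocks, List.cons.injEq, and_true] at h
  obtain ⟨h1, h2, h3⟩ := h
  have hd : d = d' := by simpa using congrArg List.length h2
  subst hd
  obtain rfl := ZVAS.rows_injective h1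
  obtain rfl := M.config_ext (List.ofFn_injective h2)
  obtain rfl := M.config_ext (List.ofFn_injective h3)
  rfl

theorem ZVASInclusionInstance.blocks_injective :
    Function.Injective ZVASInclusionInstance.blocks := by
  rintro ⟨d, M, c, N, t⟩ ⟨d', M', c', N', t'⟩ h
  simp only [ZVASInclusionInstance.blocks, List.cons.injEq, and_true] at h
  obtain ⟨h1, h2, h3, h4⟩ := h
  have hd : d = d' := by simpa using congrArg List.length h2
  subst hd
  obtain rfl := ZVAS.rows_injective h1
  obtain rfl := ZVAS.rows_injective h3
  obtain rfl := M.config_ext (List.ofFn_injective h2)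
  obtain rfl := N.config_ext (List.ofFn_injective h4)
  rfl

/-- Reachability instances as words, with numbers written according to `e`. -/
noncomputable def ZVASReachInstance.encoding (e : NumberCoding) :
    Computability.Encoding ZVASReachInstance CodeSym where
  encode I := e.encodeBlocks I.blocks
  decode := Function.partialInv fun I : ZVASReachInstance => e.encodeBlocks I.blocks
  decode_encode :=
    Function.partialInv_left (e.encodeBlocks_injective.comp ZVASReachInstance.blocks_injective)

/-- Inclusion instances as words, with numbers written according to `e`. -/
noncomputable def ZVASInclusionInstance.encoding (e : NumberCoding) :
    Computability.Encoding ZVASInclusionInstance CodeSym where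
  encode I := e.encodeBlocks I.blocks
  decode := Function.partialInv fun I : ZVASInclusionInstance => e.encodeBlocks I.blocks
  decode_encode :=
    Function.partialInv_left (e.encodeBlocks_injective.comp ZVASInclusionInstance.blocks_injective)

/-! Counters range over the integers, so the order of the letters in a run is irrelevant: a vector
is reachable iff it is the source plus a combination of the letter vectors with natural
coefficients. The proof encodes computations of length at most `T` of a nondeterministic machine in
such combinations.

Space-time is laid out on one line of cells, cut into rows of `V + 3` cells. Row `k` stands for the
tape at time `k`, and cell `i` for the tape position `i % (V + 3) - (U + 1)`, where `U = T + 1`. The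
coordinates count tokens: tape symbols and heads (states) lying in a cell. A move of cell `j` takes
tokens from cell `j` and either discards them or puts them near cell `j + (V + 3)`, the same
position one row later. A symbol may be forwarded or erased, a head executes a transition together
with the symbol under it, and only an accepting head may be discarded. Only the first `U` rows have
moves. The source holds the tokens of the initial configuration, the target is zero.

An accepting computation uses up all tokens (`reaches_zero_of_acceptsIn`). Conversely, moves put
tokens only into later cells, so a combination that ends in zero can be evaluated cell by cell: the
moves of cell `j` take exactly what the earlier cells have left there (`sum_uses_eq`). By induction
on `j` the tokens not yet processed describe a reachable configuration (`Represents`), negative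
counts never arise, and the head can only vanish by accepting in time (`acceptsIn_of_tokensBefore`).
Together this is `reaches_iff`.

Inclusion follows by taking a left system without letters started in the target: its reachability
set is a singleton.

All entries are `-1`, `0` or `1`, and apart from runs of zero blocks the row of a move is built from
words that depend on the machine alone. The same construction therefore serves unary and binary
coding. The words are written by small stack programs (`StackProg`), which compile to multi-stack
machines with a polynomial time bound (`computableInPolyTime`). -/

/-! ## Programs on finitely many stacks -/

/-- Structured programs on the stacks `k : K` with alphabets `A k`: putting a fixed word on top of
a stack, sequential composition, and popping a stack until it is empty. -/
inductive StackProg {K : Type} (A : K → Type) : Type where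
  | emit (k : K) (l : List (A k))
  | seq (P Q : StackProg A)
  | loop (k : K) (body : A k → StackProg A)

namespace StackProg

open Turing

variable {K : Type} {A : K → Type}

/-- `Exec P S S' t`: the program `P` takes the stacks from `S` to `S'` in at most `t` steps. -/
inductive Exec [DecidableEq K] : StackProg A → (∀ k, List (A k)) → (∀ k, List (A k)) → ℕ → Prop
  | emit (k : K) (l : List (A k)) (S : ∀ k, List (A k)) :
      Exec (.emit k l) S (Function.update S k (l ++ S k)) 1
  | seq {P Q : StackProg A} {S S' S'' : ∀ k, List (A k)} {t t' : ℕ} :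
      Exec P S S' t → Exec Q S' S'' t' → Exec (.seq P Q) S S'' (t + t')
  | loop_nil {k : K} {body : A k → StackProg A} {S : ∀ k, List (A k)} :
      S k = [] → Exec (.loop k body) S S 1
  | loop_cons {k : K} {body : A k → StackProg A} {S S' S'' : ∀ k, List (A k)} {a : A k}
      {l : List (A k)} {t t' : ℕ} :
      S k = a :: l → Exec (body a) (Function.update S k l) S' t →
      Exec (.loop k body) S' S'' t' → Exec (.loop k body) S S'' (t + t' + 1)
  | weaken {P : StackProg A} {S S' : ∀ k, List (A k)} {t t' : ℕ} :
      Exec P S S' t → t ≤ t' → Exec P S S' t'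

/-- The labels of the machine running a program. -/
def Label : StackProg A → Type
  | .emit _ _ => Unit
  | .seq P Q => P.Label ⊕ Q.Label
  | .loop k body => Option (Σ a : A k, (body a).Label)

theorem finite_label [∀ k, Finite (A k)] : ∀ P : StackProg A, Finite P.Label
  | .emit _ _ => inferInstanceAs (Finite Unit)
  | .seq P Q =>
    have := P.finite_label
    have := Q.finite_label
    inferInstanceAs (Finite (P.Label ⊕ Q.Label))
  | .loop k body =>
    have := fun a => (body a).finite_label
    inferInstanceAs (Finite (Option (Σ a : A k, (body a).Label)))

/-- The label at which the machine running a program starts. -/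
def entry : (P : StackProg A) → P.Label
  | .emit _ _ => ()
  | .seq P _ => Sum.inl P.entry
  | .loop _ _ => none

/-- Push a word. -/
def pushAll {Λ σ : Type} (k : K) : List (A k) → TM2.Stmt A Λ σ → TM2.Stmt A Λ σ
  | [], q => q
  | a :: l, q => pushAll k l (.push k (fun _ => a) q)

theorem stepAux_pushAll [DecidableEq K] {Λ σ : Type} (k : K) (l : List (A k))
    (q : TM2.Stmt A Λ σ) (v : σ)
    (S : ∀ k, List (A k)) :
    TM2.stepAux (pushAll k l q) v S = TM2.stepAux q v (Function.update S k (l ++ S k)) := by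
  induction l generalizing q with
  | nil => simp [pushAll]
  | cons a l ih => simp [pushAll, ih]

/-- The code of a program whose labels are embedded in `Λ` and which continues at `exit`. -/
def code [DecidableEq K] {Λ : Type} : (P : StackProg A) → (P.Label → Λ) → Λ → P.Label →
    TM2.Stmt A Λ (∀ k, Option (A k))
  | .emit k l, _, exit => fun _ => pushAll k l (.goto fun _ => exit)
  | .seq P Q, emb, exit =>
    Sum.elim (P.code (fun l => emb (Sum.inl l)) (emb (Sum.inr Q.entry)))
      (Q.code (fun l => emb (Sum.inr l)) exit)
  | .loop k body, emb, exit => fun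
    -- `none` is the loop head: the popped symbol is kept in the register of stack `k` and selects
    -- the copy of the body, whose exit is the loop head again.
    | none => .pop k (fun v o => Function.update v k o) (.goto fun v =>
        match v k with
        | none => exit
        | some a => emb (some ⟨a, (body a).entry⟩))
    | some ⟨a, l⟩ => (body a).code (fun l => emb (some ⟨a, l⟩)) (emb none) l

/-- `c'` is reached from `c` in at most `t` steps. -/
def StepsTo [DecidableEq K] {Λ σ : Type} (M : Λ → TM2.Stmt A Λ σ)
    (c c' : TM2.Cfg A Λ σ) (t : ℕ) : Prop :=
  ∃ n ≤ t, (flip bind (TM2.step M))^[n] (some c) = some c'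

theorem StepsTo.trans [DecidableEq K] {Λ σ : Type}
    {M : Λ → TM2.Stmt A Λ σ} {c c' c'' : TM2.Cfg A Λ σ} {t t' : ℕ}
    (h : StepsTo M c c' t) (h' : StepsTo M c' c'' t') : StepsTo M c c'' (t + t') := by
  obtain ⟨n, hn, e⟩ := h
  obtain ⟨n', hn', e'⟩ := h'
  exact ⟨n' + n, by omega, by rw [Function.iterate_add_apply, e, e']⟩

theorem StepsTo.single [DecidableEq K] {Λ σ : Type} {M : Λ → TM2.Stmt A Λ σ} {c c' : TM2.Cfg A Λ σ}
    (h : TM2.step M c = some c') : StepsTo M c c' 1 :=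
  ⟨1, le_rfl, h⟩

/-- Only the labels in the range of `emb` are prescribed, so the induction can pass to subprograms
with a restricted embedding and another exit. The final registers are left open because every loop
overwrites its register before reading it. -/
theorem Exec.stepsTo [DecidableEq K] {P : StackProg A} {S S' : ∀ k, List (A k)} {t : ℕ}
    (h : Exec P S S' t)
    {Λ : Type} (M : Λ → TM2.Stmt A Λ (∀ k, Option (A k))) (emb : P.Label → Λ) (exit : Λ)
    (hM : ∀ l, M (emb l) = P.code emb exit l) (v : ∀ k, Option (A k)) :
    ∃ v', StepsTo M ⟨some (emb P.entry), v, S⟩ ⟨some exit, v', S'⟩ t := by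
  induction h generalizing exit v with
  | emit k l S =>
    refine ⟨v, .single ?_⟩
    rw [TM2.step, hM]
    simp [code, stepAux_pushAll]
  | @seq P Q S S' S'' t t' _ _ ih ih' =>
    obtain ⟨v₁, h₁⟩ := ih (fun l => emb (Sum.inl l)) (emb (Sum.inr Q.entry))
      (fun l => hM (Sum.inl l)) v
    obtain ⟨v₂, h₂⟩ := ih' (fun l => emb (Sum.inr l)) exit (fun l => hM (Sum.inr l)) v₁
    exact ⟨v₂, h₁.trans h₂⟩
  | @loop_nil k body S hS =>
    refine ⟨Function.update v k none, .single ?_⟩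
    rw [TM2.step, hM]
    simp only [entry, code, TM2.stepAux, hS, List.head?_nil, List.tail_nil, Function.update_self]
    rw [← hS, Function.update_eq_self]
  | @loop_cons k body S S' S'' a l t t' hS _ _ ih ih' =>
    obtain ⟨v₁, h₁⟩ := ih (fun l => emb (some ⟨a, l⟩)) (emb none)
      (fun l => (hM (some ⟨a, l⟩)).trans (by simp only [code]))
      (Function.update v k (some a))
    obtain ⟨v₂, h₂⟩ := ih' emb exit hM v₁
    have h₀ : StepsTo M ⟨some (emb (entry (loop k body))), v, S⟩
        ⟨some (emb (some ⟨a, (body a).entry⟩)), Function.update v k (some a),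
          Function.update S k l⟩ 1 := by
      refine .single ?_
      rw [TM2.step, hM]
      simp [entry, code, hS]
    have := h₀.trans (h₁.trans h₂)
    exact ⟨v₂, by rwa [Nat.add_comm] at this⟩
  | weaken _ hle ih =>
    obtain ⟨v', n, hn, e⟩ := ih emb exit hM v
    exact ⟨v', n, hn.trans hle, e⟩

/-- The machine running a program and then halting. -/
noncomputable def machine [DecidableEq K] [Fintype K] [∀ k, Finite (A k)]
    (P : StackProg A) (k₀ k₁ : K) :
    FinTM2 where
  K := K
  k₀ := k₀
  k₁ := k₁
  Γ := A
  Λ := Option P.Label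
  main := some P.entry
  ΛFin :=
    have := P.finite_label
    Fintype.ofFinite _
  σ := ∀ k, Option (A k)
  initialState := fun _ => none
  σFin := Fintype.ofFinite _
  Γk₀Fin := Fintype.ofFinite _
  m
    -- `haltList` demands the initial internal state, so the registers are reset before halting.
    | none => .load (fun _ _ => none) .halt
    | some l => P.code some none l

/-- Brings the stacks of `initList` and `haltList`, defined by a dependent `if`, into the form used
by `Exec`. -/
theorem dite_eq_update [inst : DecidableEq K] (k₀ : K) (s : List (A k₀)) :
    (fun k => @dite (List (A k)) (k = k₀) (inst k k₀) (fun h => by rw [h]; exact s)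
      fun _ => []) = Function.update (fun _ => []) k₀ s := by
  funext k
  by_cases h : k = k₀
  · subst h
    simp
  · rw [dif_neg h, Function.update_of_ne h]

/-- A function is computable in polynomial time if some program computes it in polynomial time,
leaving all stacks but the output stack empty. -/
theorem computableInPolyTime [DecidableEq K] [Fintype K] [∀ k, Finite (A k)]
    (P : StackProg A) (k₀ k₁ : K)
    {β : Type} (enc : β → List (A k₁)) (f : List (A k₀) → β) (time : Polynomial ℕ)
    (hP : ∀ w, Exec P (Function.update (fun _ => []) k₀ w)
      (Function.update (fun _ => []) k₁ (enc (f w))) (time.eval w.length)) :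
    Nonempty (TM2ComputableInPolyTime (id : List (A k₀) → List (A k₀)) enc f) := by
  have key : ∀ w, ∃ n ≤ time.eval w.length + 1,
      (flip bind (P.machine k₀ k₁).step)^[n] (some (initList (P.machine k₀ k₁) w)) =
        some (haltList (P.machine k₀ k₁) (enc (f w))) := by
    intro w
    obtain ⟨v', hv⟩ := (hP w).stepsTo (P.machine k₀ k₁).m some none (fun _ => rfl) fun _ => none
    have hlast : StepsTo (P.machine k₀ k₁).m ⟨some none, v',
        Function.update (fun _ => []) k₁ (enc (f w))⟩
        ⟨none, fun _ => none, Function.update (fun _ => []) k₁ (enc (f w))⟩ 1 := .single rfl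
    obtain ⟨n, hn, e⟩ := hv.trans hlast
    refine ⟨n, hn, ?_⟩
    have e₁ : initList (P.machine k₀ k₁) w =
        (⟨some (some P.entry), fun _ => none, Function.update (fun _ => []) k₀ w⟩ :
          TM2.Cfg A (Option P.Label) (∀ k, Option (A k))) := by
      exact congrArg (TM2.Cfg.mk _ _) (dite_eq_update k₀ w)
    have e₂ : haltList (P.machine k₀ k₁) (enc (f w)) =
        (⟨none, fun _ => none, Function.update (fun _ => []) k₁ (enc (f w))⟩ :
          TM2.Cfg A (Option P.Label) (∀ k, Option (A k))) := by
      exact congrArg (TM2.Cfg.mk _ _) (dite_eq_update k₁ (enc (f w)))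
    rw [e₁, e₂]
    exact e
  choose n hn e using key
  refine ⟨⟨⟨P.machine k₀ k₁, Equiv.refl _, Equiv.refl _⟩, time + 1, fun w => ⟨⟨n w, ?_⟩, ?_⟩⟩⟩
  · simp only [id_eq, Equiv.invFun_as_coe, Equiv.refl_symm]
    erw [List.map_id, List.map_id]
    exact e w
  · rw [Polynomial.eval_add, Polynomial.eval_one]
    exact hn w

/-- `F i` is the content of the stacks before round `i`. Each round costs one step for its pop, and
one more step finds the stack empty. -/
theorem Exec.loop [DecidableEq K] {k : K} {body : A k → StackProg A} (b n : ℕ) (F : ℕ → ∀ k, List (A k))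
    (hF : ∀ i < n, ∃ a l, F i k = a :: l ∧ Exec (body a) (Function.update (F i) k l) (F (i + 1)) b)
    (hn : F n k = []) : Exec (.loop k body) (F 0) (F n) (n * (b + 1) + 1) := by
  induction n generalizing F with
  | zero => exact (Exec.loop_nil hn).weaken (by omega)
  | succ n ih =>
    obtain ⟨a, l, h, hb⟩ := hF 0 n.succ_pos
    refine (Exec.loop_cons h hb (ih (fun i => F (i + 1)) (fun i hi => hF (i + 1) (by omega))
      hn)).weaken ?_
    apply le_of_eq
    ring

end StackProg

/-! ## Computations as runs of a token system -/

namespace NTM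

variable {Γ : Type} (M : NTM Γ)

/-- The configuration `c` is reached in exactly `k` steps on input `w`. -/
def ReachesIn (w : List Γ) (k : ℕ) (c : M.Cfg) : Prop :=
  ∃ cs : ℕ → M.Cfg, cs 0 = M.init w ∧ (∀ i < k, M.Step (cs i) (cs (i + 1))) ∧ cs k = c

variable {M}

theorem ReachesIn.zero (w : List Γ) : M.ReachesIn w 0 (M.init w) :=
  ⟨fun _ => M.init w, rfl, by simp, rfl⟩

theorem ReachesIn.succ {w : List Γ} {k : ℕ} {c c' : M.Cfg} (h : M.ReachesIn w k c)
    (hs : M.Step c c') : M.ReachesIn w (k + 1) c' := by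
  obtain ⟨cs, h0, h1, rfl⟩ := h
  refine ⟨fun i => if i ≤ k then cs i else c', by simpa using h0, fun i hi => ?_, by simp⟩
  rcases Nat.lt_or_eq_of_le (Nat.le_of_lt_succ hi) with h | rfl
  · simpa [h.le, Nat.succ_le_iff.2 h] using h1 i h
  · simpa using hs

theorem _root_.HeadMove.abs_toInt_le (m : HeadMove) : |m.toInt| ≤ 1 := by
  cases m <;> simp [HeadMove.toInt]

theorem ReachesIn.abs_head_le {w : List Γ} {k : ℕ} {c : M.Cfg} (h : M.ReachesIn w k c) :
    |c.head| ≤ k := by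
  obtain ⟨cs, h0, h1, rfl⟩ := h
  have : ∀ i ≤ k, |(cs i).head| ≤ i := by
    intro i
    induction i with
    | zero => simp [h0, init]
    | succ i ih =>
      intro hi
      obtain ⟨t, _, _, e, _⟩ := h1 i hi
      rw [e]
      have h2 := ih (by omega)
      have h3 := HeadMove.abs_toInt_le t.2.2
      have h4 := abs_add_le (cs i).head t.2.2.toInt
      push_cast
      linarith
  exact this k le_rfl

theorem acceptsIn_iff {w : List Γ} {T : ℕ} :
    M.AcceptsIn w T ↔ ∃ k ≤ T, ∃ c, M.ReachesIn w k c ∧ c.state ∈ M.accept := by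
  constructor
  · rintro ⟨k, hk, cs, h0, h1, h2⟩
    exact ⟨k, hk, cs k, ⟨cs, h0, h1, rfl⟩, h2⟩
  · rintro ⟨k, hk, c, ⟨cs, h0, h1, rfl⟩, h2⟩
    exact ⟨k, hk, cs, h0, h1, h2⟩

variable (M)

/-- The moves of the token system: a cell keeps its symbol for the next sweep, a symbol is
discarded, the head executes a transition of the machine, the head is discarded. -/
inductive Tile where
  | idle (s : M.Sym)
  | erase (s : M.Sym)
  | act (s : M.Sym) (q : M.State) (s' : M.Sym) (q' : M.State) (m : HeadMove)
  | acc (q : M.State)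

variable {M}

/-- The moves that the machine allows. -/
def Tile.Valid : M.Tile → Prop
  | .idle _ => True
  | .erase _ => True
  | .act s q s' q' m => (q', s', m) ∈ M.next q s
  | .acc q => q ∈ M.accept

/-- The displacement of the head, increased by one. -/
def _root_.HeadMove.toNat : HeadMove → ℕ
  | .left => 0
  | .stay => 1
  | .right => 2

theorem _root_.HeadMove.toNat_eq (m : HeadMove) : (m.toNat : ℤ) = m.toInt + 1 := by
  cases m <;> simp [HeadMove.toInt, HeadMove.toNat]

theorem _root_.HeadMove.toNat_le (m : HeadMove) : m.toNat ≤ 2 := by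
  cases m <;> simp [HeadMove.toNat]

open Classical in
/-- The tokens that a move takes from its cell. -/
noncomputable def Tile.uses : M.Tile → M.Sym ⊕ M.State → ℤ
  | .idle s, c => if c = .inl s then 1 else 0
  | .erase s, c => if c = .inl s then 1 else 0
  | .act s q _ _ _, c => if c = .inl s ∨ c = .inr q then 1 else 0
  | .acc q, c => if c = .inr q then 1 else 0

open Classical in
/-- The tokens that a move of cell `j` puts in cell `i`, where a sweep consists of `V + 3` cells. -/
noncomputable def Tile.gives (V j : ℕ) : M.Tile → ℕ → M.Sym ⊕ M.State → ℤ
  | .idle s, i, c => if i = j + (V + 3) ∧ c = .inl s then 1 else 0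
  | .erase _, _, _ => 0
  | .act _ _ s' q' m, i, c =>
    (if i = j + (V + 3) ∧ c = .inl s' then 1 else 0) +
      if i = j + V + 2 + m.toNat ∧ c = .inr q' then 1 else 0
  | .acc _, _, _ => 0

/-- The effect of a move of cell `j`. -/
noncomputable def Tile.effect (V j : ℕ) (τ : M.Tile) (i : ℕ) (c : M.Sym ⊕ M.State) : ℤ :=
  τ.gives V j i c - if i = j then τ.uses c else 0

/-- The position on the tape of cell `i`. -/
def cellPos (V U i : ℕ) : ℤ := ((i % (V + 3) : ℕ) : ℤ) - (U + 1)

theorem cellPos_add (V U i : ℕ) : cellPos V U (i + (V + 3)) = cellPos V U i := by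
  simp [cellPos]

/-- A window of `V + 3` consecutive cells contains every residue modulo `V + 3` once. -/
theorem cellPos_inj {V U i i' j : ℕ} (h : cellPos V U i = cellPos V U i') (h1 : j ≤ i)
    (h2 : i < j + (V + 3)) (h3 : j ≤ i') (h4 : i' < j + (V + 3)) : i = i' := by
  have h5 : i ≡ i' [MOD (V + 3)] := by
    unfold cellPos at h
    unfold Nat.ModEq
    omega
  refine Nat.ModEq.eq_of_abs_lt h5 ?_
  rw [abs_lt]
  push_cast
  omega

/-- As `2 * U ≤ V`, the offset `U + 1 + h` stays inside its row, so the head never wraps around. -/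
theorem cellPos_eq {V U p k : ℕ} {h : ℤ} (hV : 2 * U ≤ V) (hk : k ≤ U) (hh : |h| ≤ k)
    (hp : (p : ℤ) = U + 1 + h + k * (V + 3)) : cellPos V U p = h := by
  rw [abs_le] at hh
  unfold cellPos
  push_cast
  rw [hp, Int.add_mul_emod_self_right, Int.emod_eq_of_lt] <;> omega

open Classical in
/-- The symbols of `tape` in the cells from `lo` to `hi`. -/
noncomputable def symTokens (V U lo hi : ℕ) (tape : ℤ → M.Sym) : ℕ → M.Sym ⊕ M.State → ℤ
  | i, .inl s => if (lo ≤ i ∧ i < hi) ∧ s = tape (cellPos V U i) then 1 else 0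
  | _, .inr _ => 0

open Classical in
/-- A head in cell `p`. -/
noncomputable def headToken (p : ℕ) (q : M.State) : ℕ → M.Sym ⊕ M.State → ℤ
  | _, .inl _ => 0
  | i, .inr q' => if i = p ∧ q' = q then 1 else 0

variable (M) in
/-- The tokens that represent the initial configuration. -/
noncomputable def initTokens (V U : ℕ) (w : List Γ) : ℕ → M.Sym ⊕ M.State → ℤ :=
  symTokens V U 0 (V + 3) (M.inputTape w) + headToken (U + 1) M.start

variable (M) in
/-- One move of the token system in one of the first `U * (V + 3)` cells. -/
def Fire (V U : ℕ) (v v' : ℕ → M.Sym ⊕ M.State → ℤ) : Prop :=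
  ∃ j < U * (V + 3), ∃ τ : M.Tile, τ.Valid ∧ v' = v + τ.effect V j

/-! ### Accepting computations yield runs to zero -/

theorem symTokens_self (V U lo : ℕ) (tape : ℤ → M.Sym) : symTokens V U lo lo tape = 0 := by
  funext i c
  cases c
  · simp only [symTokens, Pi.zero_apply, ite_eq_right_iff]
    omega
  · rfl

theorem fire_erase {V U lo hi : ℕ} (h : lo < hi) (hJ : lo < U * (V + 3)) (tape : ℤ → M.Sym)
    (u : ℕ → M.Sym ⊕ M.State → ℤ) :
    M.Fire V U (symTokens V U lo hi tape + u) (symTokens V U (lo + 1) hi tape + u) := by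
  refine ⟨lo, hJ, .erase (tape (cellPos V U lo)), trivial, ?_⟩
  rw [add_right_comm _ u]
  congr 1
  funext i c
  rcases c with s | q
  · simp only [symTokens, Pi.add_apply, Tile.effect, Tile.gives, Tile.uses, Sum.inl.injEq]
    rcases eq_or_ne i lo with rfl | hi'
    · by_cases hs : s = tape (cellPos V U i) <;> simp [hs, h]
    · by_cases hs : s = tape (cellPos V U i)
      · simp only [hs, and_true, hi', if_false, sub_self, add_zero]
        congr 1
        apply propext
        omega
      · simp [hs, hi']
  · simp [symTokens, Tile.effect, Tile.gives, Tile.uses]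

/-- The symbol leaving the window on the left reenters it on the right, in a cell with the same tape
position. -/
theorem fire_idle {V U lo : ℕ} (hJ : lo < U * (V + 3)) (tape : ℤ → M.Sym)
    (u : ℕ → M.Sym ⊕ M.State → ℤ) :
    M.Fire V U (symTokens V U lo (lo + (V + 3)) tape + u)
      (symTokens V U (lo + 1) (lo + 1 + (V + 3)) tape + u) := by
  refine ⟨lo, hJ, .idle (tape (cellPos V U lo)), trivial, ?_⟩
  rw [add_right_comm _ u]
  congr 1
  funext i c
  rcases c with s | q
  · simp only [symTokens, Pi.add_apply, Tile.effect, Tile.gives, Tile.uses, Sum.inl.injEq]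
    rcases eq_or_ne i lo with rfl | hi'
    · by_cases hs : s = tape (cellPos V U i) <;> simp [hs]
    · rcases eq_or_ne i (lo + (V + 3)) with rfl | hi2
      · rw [cellPos_add]
        by_cases hs : s = tape (cellPos V U lo)
        · have : lo + 1 ≤ lo + (V + 3) := by omega
          simp [hs]
        · simp [hs]
      · simp only [hi2, false_and, if_false, zero_sub]
        by_cases hs : s = tape (cellPos V U i)
        · simp only [hs, and_true, hi', if_false, neg_zero, add_zero]
          congr 1
          apply propext
          omega
        · simp [hs, hi']
  · simp [symTokens, Tile.effect, Tile.gives, Tile.uses]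

theorem reaches_erase {V U lo hi : ℕ} (h : lo ≤ hi) (hJ : hi ≤ U * (V + 3)) (tape : ℤ → M.Sym)
    (u : ℕ → M.Sym ⊕ M.State → ℤ) :
    Relation.ReflTransGen (M.Fire V U) (symTokens V U lo hi tape + u) u := by
  induction h using Nat.decreasingInduction with
  | self => rw [symTokens_self, zero_add]
  | of_succ k hk ih => exact .head (fire_erase hk (by omega) tape u) ih

/-- Symbols are forwarded as long as the new cell is among the first `U * (V + 3)`, and erased
afterwards, because no move could remove them from a later cell. This explains the `min`. -/
theorem reaches_sweep {V U lo p : ℕ} (h : lo ≤ p) (hJ : p ≤ U * (V + 3)) (tape : ℤ → M.Sym)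
    (u : ℕ → M.Sym ⊕ M.State → ℤ) :
    Relation.ReflTransGen (M.Fire V U)
      (symTokens V U lo (min (lo + (V + 3)) (U * (V + 3))) tape + u)
      (symTokens V U p (min (p + (V + 3)) (U * (V + 3))) tape + u) := by
  induction p, h using Nat.le_induction with
  | base => exact .refl
  | succ p hp ih =>
    refine (ih (by omega)).tail ?_
    rcases lt_or_ge (p + (V + 3)) (U * (V + 3)) with h | h
    · rw [min_eq_left h.le, min_eq_left (by omega)]
      exact fire_idle (by omega) tape u
    · rw [min_eq_right h, min_eq_right (by omega)]
      exact fire_erase (by omega) (by omega) tape u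

/-- The window slides by one cell. The only position that leaves and reenters it is `c.head`, which
is exactly where the two tapes may differ. -/
theorem fire_act {V U p p' : ℕ} (hJ : p + (V + 3) < U * (V + 3)) {c c' : M.Cfg}
    {m : HeadMove} {s' : M.Sym} (ht : (c'.state, s', m) ∈ M.next c.state (c.tape c.head))
    (htape : c'.tape = Function.update c.tape c.head s') (hp : cellPos V U p = c.head)
    (hp' : p' = p + V + 2 + m.toNat) :
    M.Fire V U
      (symTokens V U p (min (p + (V + 3)) (U * (V + 3))) c.tape + headToken p c.state)
      (symTokens V U (p + 1) (min (p + 1 + (V + 3)) (U * (V + 3))) c'.tape +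
        headToken p' c'.state) := by
  refine ⟨p, by omega, .act (c.tape c.head) c.state s' c'.state m, ht, ?_⟩
  rw [min_eq_left hJ.le, min_eq_left (by omega)]
  funext i d
  rcases d with s | q
  · simp only [symTokens, headToken, Pi.add_apply, Tile.effect, Tile.gives, Tile.uses,
      Sum.inl.injEq, htape]
    rcases eq_or_ne i p with rfl | hi'
    · by_cases hs : s = c.tape c.head <;> simp [hs, hp]
    · rcases eq_or_ne i (p + (V + 3)) with rfl | hi2
      · rw [cellPos_add, hp]
        by_cases hs : s = s'
        · simp [hs]
        · simp [hs]
      · simp only [hi2, false_and, if_false, reduceCtorEq, and_false]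
        by_cases hin : p + 1 ≤ i ∧ i < p + 1 + (V + 3)
        · have hne : cellPos V U i ≠ c.head := fun he =>
            hi' (cellPos_inj (j := p) (he.trans hp.symm) (by omega) (by omega) (by omega)
              (by omega))
          have h1 : p ≤ i ∧ i < p + (V + 3) := by omega
          simp only [hi', if_false, sub_zero, add_zero]
          congr 1
          simp [hin, h1, Function.update_of_ne hne]
        · have h1 : ¬ (p ≤ i ∧ i < p + (V + 3)) := by omega
          simp only [hin, h1, hi', false_and, if_false]
          simp
  · simp only [symTokens, headToken, Pi.add_apply, Tile.effect, Tile.gives, Tile.uses,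
      Sum.inr.injEq, hp', reduceCtorEq, and_false, if_false, zero_add, false_or]
    rcases eq_or_ne i p with rfl | hi'
    · have h1 : i ≠ i + V + 2 + m.toNat := by omega
      by_cases hs : q = c.state <;> simp [hs, h1]
    · simp only [hi', false_and, if_false, sub_zero, zero_add]
      congr 1
      simp

theorem head_cell_lt {V U p k : ℕ} {h : ℤ} (hV : 2 * U ≤ V) (hk : k < U) (hh : |h| ≤ k)
    (hp : (p : ℤ) = U + 1 + h + k * (V + 3)) : p < U * (V + 3) := by
  rw [abs_le] at hh
  obtain ⟨r, rfl⟩ := Nat.exists_eq_add_of_lt hk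
  zify at *
  rw [hp]
  have : (0 : ℤ) ≤ r * (V + 3) := by positivity
  nlinarith

theorem head_cell_add_lt {V U p k : ℕ} {h : ℤ} (hV : 2 * U ≤ V) (hk : k + 1 < U) (hh : |h| ≤ k)
    (hp : (p : ℤ) = U + 1 + h + k * (V + 3)) : p + (V + 3) < U * (V + 3) := by
  rw [abs_le] at hh
  obtain ⟨r, rfl⟩ := Nat.exists_eq_add_of_lt hk
  zify at *
  rw [hp]
  have : (0 : ℤ) ≤ r * (V + 3) := by positivity
  nlinarith

/-- From `h ≥ -k` one gets `p ≥ U + 1 + k * (V + 2)`, which exceeds `U * (V + 3)` once `k ≥ U`. So a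
head in a cell with moves belongs to a time below `U`; this bounds the accepting time. -/
theorem lt_of_head_cell_lt {V U p k : ℕ} {h : ℤ} (hh : |h| ≤ k)
    (hp : (p : ℤ) = U + 1 + h + k * (V + 3)) (hJ : p < U * (V + 3)) : k < U := by
  rw [abs_le] at hh
  by_contra hk
  obtain ⟨r, rfl⟩ := Nat.exists_eq_add_of_le (not_lt.1 hk)
  zify at *
  rw [hp] at hJ
  have : (0 : ℤ) ≤ r * (V + 2) := by positivity
  nlinarith

/-- An accepting computation gives a run of the token system that uses up all tokens. -/
theorem reaches_zero_of_acceptsIn {V U : ℕ} (hV : 2 * U ≤ V) {w : List Γ} {T : ℕ}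
    (hT : T < U) (h : M.AcceptsIn w T) :
    Relation.ReflTransGen (M.Fire V U) (M.initTokens V U w) 0 := by
  obtain ⟨k, hk, cs, h0, h1, hacc⟩ := h
  -- After `i` steps all cells before the head's cell `p` have been processed, and `p` is next.
  have key : ∀ i ≤ k, ∃ p : ℕ, (p : ℤ) = U + 1 + (cs i).head + i * (V + 3) ∧
      Relation.ReflTransGen (M.Fire V U) (M.initTokens V U w)
        (symTokens V U p (min (p + (V + 3)) (U * (V + 3))) (cs i).tape +
          headToken p (cs i).state) := by
    intro i
    induction i with
    | zero =>
      intro _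
      refine ⟨U + 1, by simp [h0, init], ?_⟩
      have h2 : U + 1 ≤ U * (V + 3) := by nlinarith
      have h3 : V + 3 ≤ U * (V + 3) := by nlinarith
      have := reaches_sweep (V := V) (Nat.zero_le (U + 1)) h2 (M.inputTape w)
        (headToken (U + 1) M.start)
      rw [zero_add, min_eq_left h3] at this
      simpa [h0, init, initTokens] using this
    | succ i ih =>
      intro hi
      obtain ⟨p, hp, hr⟩ := ih (by omega)
      obtain ⟨⟨q', s', m⟩, ht, hq, hhead, htape⟩ := h1 i (by omega)
      have hb : |(cs i).head| ≤ i :=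
        ReachesIn.abs_head_le ⟨cs, h0, fun i' hi' => h1 i' (by omega), rfl⟩
      have hb' : |(cs (i + 1)).head| ≤ (i + 1 : ℕ) :=
        ReachesIn.abs_head_le ⟨cs, h0, fun i' hi' => h1 i' (by omega), rfl⟩
      have hm := m.toNat_eq
      simp only at ht hq hhead htape
      have hp' : ((p + V + 2 + m.toNat : ℕ) : ℤ) =
          U + 1 + (cs (i + 1)).head + (i + 1 : ℕ) * (V + 3) := by
        push_cast
        rw [hhead, hp, hm]
        ring
      refine ⟨p + V + 2 + m.toNat, hp', hr.trans ?_⟩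
      rw [← hq] at ht
      refine .head (fire_act (head_cell_add_lt hV (by omega) hb hp) ht htape
        (cellPos_eq hV (by omega) hb hp) rfl) ?_
      exact reaches_sweep (by omega) (head_cell_lt hV (by omega) hb' hp').le _ _
  obtain ⟨p, hp, hr⟩ := key k le_rfl
  have hb : |(cs k).head| ≤ k := ReachesIn.abs_head_le ⟨cs, h0, h1, rfl⟩
  have hpJ := head_cell_lt hV (by omega) hb hp
  -- The accepting head is discarded, then the remaining symbols are erased one by one.
  refine hr.trans (.head (b := symTokens V U p (min (p + (V + 3)) (U * (V + 3))) (cs k).tape + 0)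
    ⟨p, hpJ, .acc (cs k).state, hacc, ?_⟩ (reaches_erase (by omega) (by omega) _ _))
  rw [add_assoc]
  congr 1
  funext i c
  rcases c with s | q
  · simp [headToken, Tile.effect, Tile.gives, Tile.uses]
  · by_cases h1 : i = p <;> by_cases h2 : q = (cs k).state <;>
      simp [headToken, Tile.effect, Tile.gives, Tile.uses, h1, h2]

end NTM

/-! ### Runs to zero yield accepting computations -/

namespace NTM

variable {Γ : Type} {M : NTM Γ}

theorem Tile.uses_nonneg (τ : M.Tile) (c : M.Sym ⊕ M.State) : 0 ≤ τ.uses c := by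
  cases τ <;> simp only [Tile.uses] <;> split_ifs <;> simp

theorem Tile.mul_uses_nonneg (x : ℕ) (τ : M.Tile) (c : M.Sym ⊕ M.State) :
    0 ≤ (x : ℤ) * τ.uses c :=
  mul_nonneg (by positivity) (τ.uses_nonneg c)

/-- Moves give tokens only at least `V + 2` cells further on. The system of equations is therefore
triangular in the cells, which replaces the missing order of the moves. -/
theorem Tile.gives_of_lt {V j i : ℕ} (τ : M.Tile) (h : i < j + V + 2) (c : M.Sym ⊕ M.State) :
    τ.gives V j i c = 0 := by
  have h1 : i ≠ j + (V + 3) := by omega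
  cases τ with
  | act s q s' q' m =>
    have h2 : i ≠ j + V + 2 + m.toNat := by omega
    simp [Tile.gives, h1, h2]
  | _ => simp [Tile.gives, h1]

theorem Tile.gives_inl_of_ne {V j i : ℕ} (τ : M.Tile) (h : i ≠ j + (V + 3)) (s : M.Sym) :
    τ.gives V j i (.inl s) = 0 := by
  cases τ <;> simp [Tile.gives, h]

variable [Fintype {τ : M.Tile // τ.Valid}]

/-- The total effect of the moves of cell `j` counted by `n`. -/
noncomputable def cellEffect (V : ℕ) (n : ℕ → {τ : M.Tile // τ.Valid} → ℕ) (j i : ℕ)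
    (c : M.Sym ⊕ M.State) : ℤ :=
  ∑ τ, (n j τ : ℤ) * τ.1.effect V j i c

/-- The tokens after the moves of the cells before `j`. -/
noncomputable def tokensBefore (V : ℕ) (n : ℕ → {τ : M.Tile // τ.Valid} → ℕ)
    (v : ℕ → M.Sym ⊕ M.State → ℤ) (j i : ℕ) (c : M.Sym ⊕ M.State) : ℤ :=
  v i c + ∑ j' ∈ Finset.range j, cellEffect V n j' i c

variable {V U : ℕ} {n : ℕ → {τ : M.Tile // τ.Valid} → ℕ} {v : ℕ → M.Sym ⊕ M.State → ℤ}

theorem tokensBefore_succ (j i : ℕ) (c : M.Sym ⊕ M.State) :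
    tokensBefore V n v (j + 1) i c = tokensBefore V n v j i c + cellEffect V n j i c := by
  simp [tokensBefore, Finset.sum_range_succ, add_assoc]

theorem cellEffect_of_lt {j i : ℕ} (h : i < j) (c : M.Sym ⊕ M.State) :
    cellEffect V n j i c = 0 := by
  refine Finset.sum_eq_zero fun τ _ => ?_
  rw [Tile.effect, Tile.gives_of_lt _ (by omega), if_neg (by omega)]
  simp

theorem cellEffect_self (j : ℕ) (c : M.Sym ⊕ M.State) :
    cellEffect V n j j c = -∑ τ, (n j τ : ℤ) * τ.1.uses c := by
  rw [cellEffect, ← Finset.sum_neg_distrib]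
  refine Finset.sum_congr rfl fun τ _ => ?_
  rw [Tile.effect, Tile.gives_of_lt _ (by omega), if_pos rfl]
  ring

theorem tokensBefore_of_le {j J i : ℕ} (h : j ≤ J) (hi : i < j) (c : M.Sym ⊕ M.State) :
    tokensBefore V n v J i c = tokensBefore V n v j i c := by
  induction J, h using Nat.le_induction with
  | base => rfl
  | succ J hJ ih => rw [tokensBefore_succ, ih, cellEffect_of_lt (by omega), add_zero]

/-- If all tokens of cell `j` are used up in the end, then the moves of this cell use exactly the
tokens that it holds after the moves of the earlier cells. -/
theorem sum_uses_eq {j J : ℕ} (h : j < J) {c : M.Sym ⊕ M.State}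
    (h0 : tokensBefore V n v J j c = 0) :
    ∑ τ, (n j τ : ℤ) * τ.1.uses c = tokensBefore V n v j j c := by
  rw [tokensBefore_of_le h (Nat.lt_succ_self j), tokensBefore_succ, cellEffect_self] at h0
  linarith

theorem count_le {j : ℕ} {c : M.Sym ⊕ M.State} {b : ℤ}
    (h : ∑ τ, (n j τ : ℤ) * τ.1.uses c = b) (τ : {τ : M.Tile // τ.Valid}) (hτ : τ.1.uses c = 1) :
    (n j τ : ℤ) ≤ b := by
  have := Finset.single_le_sum (fun τ _ => τ.1.mul_uses_nonneg (n j τ) c) (Finset.mem_univ τ)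
  rw [h, hτ, mul_one] at this
  exact this

/-- Two different moves that need the same token compete for it; with `b = 1` they cannot both
occur. -/
theorem count_add_le {j : ℕ} {c : M.Sym ⊕ M.State} {b : ℤ}
    (h : ∑ τ, (n j τ : ℤ) * τ.1.uses c = b) {τ τ' : {τ : M.Tile // τ.Valid}} (hne : τ ≠ τ')
    (hτ : τ.1.uses c = 1) (hτ' : τ'.1.uses c = 1) : (n j τ : ℤ) + n j τ' ≤ b := by
  classical
  have := Finset.sum_le_sum_of_subset_of_nonneg (Finset.subset_univ {τ, τ'})
    (fun τ _ _ => τ.1.mul_uses_nonneg (n j τ) c)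
  rw [h, Finset.sum_pair hne, hτ, hτ', mul_one, mul_one] at this
  exact this

variable (M V U n v) in
/-- Before cell `j` is processed the tokens represent a configuration of the machine. Symbols may
have been discarded. -/
def Represents (w : List Γ) (j : ℕ) (k : ℕ) (c : M.Cfg) (p : ℕ) : Prop :=
  M.ReachesIn w k c ∧ (p : ℤ) = U + 1 + c.head + k * (V + 3) ∧ j ≤ p ∧ p ≤ j + (V + 3) ∧
    (∀ i, j ≤ i → ∀ q, tokensBefore V n v j i (.inr q) = headToken p c.state i (.inr q)) ∧
    (∀ i, j ≤ i → i < j + (V + 3) → ∀ s, 0 ≤ tokensBefore V n v j i (.inl s) ∧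
      (0 < tokensBefore V n v j i (.inl s) →
        tokensBefore V n v j i (.inl s) = 1 ∧ s = c.tape (cellPos V U i))) ∧
    ∀ i, j + (V + 3) ≤ i → ∀ s, tokensBefore V n v j i (.inl s) = 0

theorem represents_init (w : List Γ) (hV : 2 * U ≤ V) :
    Represents M V U n (M.initTokens V U w) w 0 0 (M.init w) (U + 1) := by
  refine ⟨.zero w, by simp [init], by omega, by omega, ?_, ?_, ?_⟩
  · intro i _ q
    simp [tokensBefore, initTokens, symTokens, init]
  · intro i _ hi s
    rw [zero_add] at hi
    by_cases hs : s = M.inputTape w (cellPos V U i) <;>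
      simp [tokensBefore, initTokens, symTokens, headToken, hi, init, hs]
  · intro i hi s
    rw [zero_add] at hi
    simp [tokensBefore, initTokens, symTokens, headToken, hi.not_gt]

/-- Without `act` and `acc`, the moves of cell `j` take no head token, so the head cannot be there.
What remains forwards or drops symbols, and the same configuration is represented from cell `j + 1`
on. -/
theorem Represents.idle {w : List Γ} {j J k p : ℕ} {c : M.Cfg}
    (h : Represents M V U n v w j k c p) (hj : j < J)
    (h0 : ∀ d, tokensBefore V n v J j d = 0)
    (hact : ∀ s q s' q' m h, n j ⟨.act s q s' q' m, h⟩ = 0) (hacc : ∀ q h, n j ⟨.acc q, h⟩ = 0) :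
    Represents M V U n v w (j + 1) k c p := by
  obtain ⟨hr, hp, hjp, hpj, hst, hsym, hz⟩ := h
  -- A head in cell `j` would have to be taken by a move of this cell.
  have hne : j ≠ p := by
    rintro rfl
    have h1 := sum_uses_eq hj (h0 (.inr c.state))
    rw [hst j le_rfl] at h1
    have h2 : ∑ τ, (n j τ : ℤ) * τ.1.uses (.inr c.state) = 0 := by
      refine Finset.sum_eq_zero fun τ _ => ?_
      obtain ⟨τ, hτ⟩ := τ
      cases τ <;> simp [Tile.uses, hact, hacc]
    rw [h2] at h1
    simp [headToken] at h1
  have hgives : ∀ τ : {τ : M.Tile // τ.Valid}, n j τ ≠ 0 → ∀ i d, τ.1.gives V j i d =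
      if i = j + (V + 3) then τ.1.gives V j i d else 0 := by
    rintro ⟨τ, hτ⟩ hn i d
    cases τ with
    | act => simp [hact] at hn
    | acc => simp [hacc] at hn
    | _ => simp +contextual [Tile.gives]
  have hi0 : ∀ i, j < i → i ≠ j + (V + 3) → ∀ d, cellEffect V n j i d = 0 := by
    intro i hi hi' d
    refine Finset.sum_eq_zero fun τ _ => ?_
    by_cases hn : n j τ = 0
    · simp [hn]
    · rw [Tile.effect, hgives τ hn, if_neg hi', if_neg (by omega)]
      simp
  have hr0 : ∀ i, j < i → ∀ q, cellEffect V n j i (.inr q) = 0 := by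
    intro i hi q
    refine Finset.sum_eq_zero fun τ _ => ?_
    obtain ⟨τ, hτ⟩ := τ
    cases τ <;> simp [Tile.effect, Tile.gives, hact, hacc, hi.ne']
  -- The number of forwarded copies of `s` lies between zero and the number of copies that were
  -- present.
  have hlast : ∀ s, 0 ≤ cellEffect V n j (j + (V + 3)) (.inl s) ∧
      cellEffect V n j (j + (V + 3)) (.inl s) ≤ tokensBefore V n v j j (.inl s) := by
    intro s
    rw [← sum_uses_eq hj (h0 (.inl s))]
    have : ∀ τ : {τ : M.Tile // τ.Valid},
        0 ≤ (n j τ : ℤ) * τ.1.effect V j (j + (V + 3)) (.inl s) ∧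
        (n j τ : ℤ) * τ.1.effect V j (j + (V + 3)) (.inl s) ≤ (n j τ : ℤ) * τ.1.uses (.inl s) := by
      rintro ⟨τ, hτ⟩
      cases τ with
      | act => simp [hact]
      | acc => simp [hacc]
      | idle s' => by_cases hs : s = s' <;> simp [Tile.effect, Tile.gives, Tile.uses, hs]
      | erase s' => by_cases hs : s = s' <;> simp [Tile.effect, Tile.gives, Tile.uses, hs]
    exact ⟨Finset.sum_nonneg fun τ _ => (this τ).1, Finset.sum_le_sum fun τ _ => (this τ).2⟩
  refine ⟨hr, hp, by omega, by omega, ?_, ?_, ?_⟩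
  · intro i hi q
    rw [tokensBefore_succ, hr0 i (by omega), add_zero, hst i (by omega)]
  · intro i hi hi2 s
    rw [tokensBefore_succ]
    rcases eq_or_ne i (j + (V + 3)) with rfl | hi'
    · rw [hz _ le_rfl, zero_add, cellPos_add]
      have h1 := hsym j le_rfl (by omega) s
      have h2 := hlast s
      refine ⟨h2.1, fun hpos => ?_⟩
      have h3 := h1.2 (by omega)
      exact ⟨by omega, h3.2⟩
    · rw [hi0 i (by omega) hi', add_zero]
      exact hsym i (by omega) (by omega) s
  · intro i hi s
    rw [tokensBefore_succ, hi0 i (by omega) (by omega), add_zero]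
    exact hz i (by omega) s

/-- An `act` move needs a head token and a symbol token of cell `j`. Hence the head is in this cell,
the symbol has not been discarded, and both agree with the configuration. Each of these tokens
exists once, so this move occurs once and no other move of the cell occurs: a genuine step of the
machine. -/
theorem Represents.act {w : List Γ} {j J k p : ℕ} {c : M.Cfg} (hV : 2 * U ≤ V) (hk : k ≤ U)
    (h : Represents M V U n v w j k c p) (hj : j < J)
    (h0 : ∀ d, tokensBefore V n v J j d = 0) {s s' : M.Sym} {q q' : M.State} {m : HeadMove}
    {ht : (Tile.act s q s' q' m).Valid} (hn : n j ⟨.act s q s' q' m, ht⟩ ≠ 0) :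
    ∃ c' p', Represents M V U n v w (j + 1) (k + 1) c' p' := by
  obtain ⟨hr, hp, hjp, hpj, hst, hsym, hz⟩ := h
  have hq := sum_uses_eq hj (h0 (.inr q))
  have hs := sum_uses_eq hj (h0 (.inl s))
  have hq1 := count_le hq ⟨.act s q s' q' m, ht⟩ (by simp [Tile.uses])
  have hs1 := count_le hs ⟨.act s q s' q' m, ht⟩ (by simp [Tile.uses])
  have hst' : j = p ∧ q = c.state := by
    rw [hst j le_rfl] at hq1
    by_contra hcon
    rw [headToken, if_neg hcon] at hq1
    omega
  obtain ⟨rfl, rfl⟩ := hst'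
  have htok : tokensBefore V n v j j (.inr c.state) = 1 := by
    rw [hst j le_rfl]
    simp [headToken]
  obtain ⟨hsone, rfl⟩ := (hsym j le_rfl (by omega) s).2 (by omega)
  have hpos : cellPos V U j = c.head := cellPos_eq hV hk hr.abs_head_le hp
  rw [htok] at hq hq1
  rw [hsone] at hs hs1
  have hone : n j ⟨.act (c.tape (cellPos V U j)) c.state s' q' m, ht⟩ = 1 := by omega
  -- Every other move takes a symbol or a head from cell `j`; it would need the very token that is
  -- already spent.
  have hother : ∀ τ, τ ≠ ⟨.act (c.tape (cellPos V U j)) c.state s' q' m, ht⟩ → n j τ = 0 := by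
    intro τ hτ
    by_contra hcon
    have huse : ∀ d, (0 : ℤ) < tokensBefore V n v j j d → tokensBefore V n v j j d = 1 →
        τ.1.uses d = 1 →
        Tile.uses (.act (c.tape (cellPos V U j)) c.state s' q' m) d = 1 → False := by
      intro d _ hd h1 h2
      have := count_add_le ((sum_uses_eq hj (h0 d)).trans hd) hτ h1 h2
      omega
    have hsymtau : ∀ s₁, τ.1.uses (.inl s₁) = 1 → False := by
      intro s₁ h1
      have h2 := count_le (sum_uses_eq hj (h0 (.inl s₁))) τ h1
      obtain ⟨h3, rfl⟩ := (hsym j le_rfl (by omega) s₁).2 (by omega)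
      exact huse _ (by omega) h3 h1 (by simp [Tile.uses])
    obtain ⟨τ, hv⟩ := τ
    cases τ with
    | acc q₁ =>
      have h1 : Tile.uses (Tile.acc q₁) (.inr q₁) = 1 := by simp [Tile.uses]
      have h2 := count_le (sum_uses_eq hj (h0 (.inr q₁))) ⟨.acc q₁, hv⟩ h1
      have h3 : q₁ = c.state := by
        by_contra hne
        rw [hst j le_rfl] at h2
        simp [headToken, hne] at h2
        omega
      subst h3
      exact huse _ (by omega) htok h1 (by simp [Tile.uses])
    | idle s₁ => exact hsymtau s₁ (by simp [Tile.uses])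
    | erase s₁ => exact hsymtau s₁ (by simp [Tile.uses])
    | act s₁ => exact hsymtau s₁ (by simp [Tile.uses])
  have heff : ∀ i d, cellEffect V n j i d =
      Tile.effect V j (.act (c.tape (cellPos V U j)) c.state s' q' m) i d := by
    intro i d
    rw [cellEffect, Finset.sum_eq_single ⟨.act (c.tape (cellPos V U j)) c.state s' q' m, ht⟩, hone]
    · simp
    · intro τ _ hτ
      simp [hother τ hτ]
    · simp
  have hmt := m.toNat_eq
  have hml := m.toNat_le
  refine ⟨⟨q', c.head + m.toInt, Function.update c.tape c.head s'⟩, j + V + 2 + m.toNat,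
    hr.succ ⟨(q', s', m), by rwa [hpos] at ht, rfl, rfl, rfl⟩, ?_, by omega, by omega,
    ?_, ?_, ?_⟩
  · push_cast
    rw [hp, hmt]
    ring
  · intro i hi q
    rw [tokensBefore_succ, hst i (by omega), heff]
    have h1 : i ≠ j := by omega
    simp only [headToken, Tile.effect, Tile.gives, h1, reduceCtorEq, and_false, if_false,
      zero_add, sub_zero, false_and]
    congr 1
    simp
  · intro i hi hi2 s
    rw [tokensBefore_succ, heff, Tile.effect, if_neg (by omega), sub_zero]
    rcases eq_or_ne i (j + (V + 3)) with rfl | hi'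
    · rw [hz _ le_rfl, zero_add, cellPos_add, hpos]
      by_cases hs : s = s' <;> simp [Tile.gives, hs]
    · rw [Tile.gives_inl_of_ne _ hi', add_zero]
      have hne : cellPos V U i ≠ c.head := fun he =>
        (show i ≠ j by omega) (cellPos_inj (j := j) (he.trans hpos.symm) (by omega) (by omega)
          (by omega) (by omega))
      simp only [Function.update_of_ne hne]
      exact hsym i (by omega) (by omega) s
  · intro i hi s
    rw [tokensBefore_succ, heff, Tile.effect, if_neg (by omega), sub_zero,
      Tile.gives_inl_of_ne _ (by omega), add_zero]
    exact hz i (by omega) s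

/-- If a combination of moves uses up all tokens then the machine accepts. -/
theorem acceptsIn_of_tokensBefore {w : List Γ} {T : ℕ} (hU : U = T + 1) (hV : 2 * U ≤ V)
    (hl : ∀ i < U * (V + 3), ∀ d, tokensBefore V n (M.initTokens V U w) (U * (V + 3)) i d = 0)
    (hh : ∀ i ≤ U * (V + 3) + (V + 3), ∀ q,
      tokensBefore V n (M.initTokens V U w) (U * (V + 3)) i (.inr q) = 0) :
    M.AcceptsIn w T := by
  -- If the machine does not accept in time, no `acc` move is ever possible, so the head survives
  -- the processing of all cells and contradicts `hh`.
  by_contra hcon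
  have key : ∀ j ≤ U * (V + 3), ∃ k c p,
      Represents M V U n (M.initTokens V U w) w j k c p := by
    intro j
    induction j with
    | zero => exact fun _ => ⟨_, _, _, represents_init w hV⟩
    | succ j ih =>
      intro hj
      obtain ⟨k, c, p, h⟩ := ih (by omega)
      have hkU : j = p → k < U := by
        rintro rfl
        exact lt_of_head_cell_lt h.1.abs_head_le h.2.1 (by omega)
      have hhead : ∀ q τ, n j τ ≠ 0 → τ.1.uses (.inr q) = 1 → j = p ∧ q = c.state := by
        intro q τ hn hτ
        by_contra hne
        have := count_le (sum_uses_eq hj (hl j hj (.inr q))) τ hτ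
        rw [h.2.2.2.2.1 j le_rfl, headToken, if_neg hne] at this
        omega
      by_cases hacc : ∀ q h, n j ⟨.acc q, h⟩ = 0
      · by_cases hact : ∀ s q s' q' m h, n j ⟨.act s q s' q' m, h⟩ = 0
        · exact ⟨k, c, p, h.idle hj (hl j hj) hact hacc⟩
        · push Not at hact
          obtain ⟨s, q, s', q', m, ht, hn⟩ := hact
          have := hkU (hhead q _ hn (by simp [Tile.uses])).1
          obtain ⟨c', p', h'⟩ := h.act hV this.le hj (hl j hj) hn
          exact ⟨_, c', p', h'⟩
      · push Not at hacc
        obtain ⟨q, hq, hn⟩ := hacc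
        obtain ⟨h1, rfl⟩ := hhead q _ hn (by simp [Tile.uses])
        -- `k < U = T + 1` is the time bound `k ≤ T`.
        exact absurd (acceptsIn_iff.2 ⟨k, by have := hkU h1; omega, c, h.1, hq⟩) hcon
  obtain ⟨k, c, p, h⟩ := key _ le_rfl
  have h1 := hh p h.2.2.2.1 c.state
  rw [h.2.2.2.2.1 p h.2.2.1] at h1
  simp [headToken] at h1

end NTM

/-! ## Integer vector addition systems given by lists of vectors -/

/-- The `ZVAS` in which the letter `a` adds the vector `b a`. -/
def ZVAS.ofVectors {d : ℕ} (hd : 0 < d) {m : ℕ} (b : Fin m → Fin d → ℤ) : ZVAS d where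
  dim_pos := hd
  numStates := 1
  numLetters := m
  trans := Finset.univ
  τ a v := v + b a
  affine a := ⟨1, rfl, b a, fun v => by simp⟩
  single := rfl

namespace ZVAS

variable {d m : ℕ} {hd : 0 < d} {b : Fin m → Fin d → ℤ}

/-- A configuration of a `ZVAS` given by its vectors. -/
def cfg (hd : 0 < d) (b : Fin m → Fin d → ℤ) (v : Fin d → ℤ) : (ofVectors hd b).Config :=
  ((0 : Fin 1), v)

theorem reaches_add (v : Fin d → ℤ) (a : Fin m) :
    ∃ a', (ofVectors hd b).StepOn a' (cfg hd b v) (cfg hd b (v + b a)) :=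
  ⟨a, Finset.mem_univ _, rfl⟩

/-- A run is reduced to the numbers of occurrences of its letters. -/
theorem exists_count_of_reaches {c c' : (ofVectors hd b).Config}
    (h : (ofVectors hd b).Reaches c c') :
    ∃ n : Fin m → ℕ, c'.2 = c.2 + ∑ a, (n a : ℤ) • b a := by
  classical
  induction h with
  | refl => exact ⟨0, by simp⟩
  | tail _ hs ih =>
    obtain ⟨n, hn⟩ := ih
    obtain ⟨a, _, ha⟩ := hs
    let a' : Fin m := a
    refine ⟨n + Pi.single a' 1, ?_⟩
    rw [ha, show (ofVectors hd b).τ a = fun v => v + b a' from rfl]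
    simp only [hn, Pi.add_apply, Nat.cast_add, add_smul, Finset.sum_add_distrib, add_assoc]
    congr 2
    rw [Finset.sum_eq_single a']
    · simp
    · intro x _ hx
      simp [Pi.single_eq_of_ne hx]
    · simp

theorem rows_ofVectors :
    (ofVectors hd b).rows = List.ofFn fun a => (1 : ℤ) :: List.ofFn (b a) := by
  unfold rows
  congr 1
  funext a
  have h1 : ∃ q q', (q, a, q') ∈ (ofVectors hd b).trans :=
    ⟨(0 : Fin 1), (0 : Fin 1), Finset.mem_univ _⟩
  have h2 : (ofVectors hd b).τ a 0 = b a := zero_add _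
  rw [if_pos h1, h2]

theorem config_eq_cfg (c : (ofVectors hd b).Config) : c = cfg hd b c.2 :=
  (ofVectors hd b).config_ext rfl

end ZVAS

/-! ### Lists indexed by products and ranges -/

theorem List.ofFn_finProdFinEquiv {α : Type} {m n : ℕ} (f : Fin m × Fin n → α) :
    List.ofFn (fun x : Fin (m * n) => f (finProdFinEquiv.symm x)) =
      (List.ofFn fun i => List.ofFn fun j => f (i, j)).flatten := by
  rw [List.ofFn_mul]
  congr 2
  funext i
  congr 1
  funext j
  congr 1
  rw [Equiv.symm_apply_eq]
  ext
  simp [mul_comm, add_comm]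

theorem List.flatMap_range_add {α : Type} (a b : ℕ) (g : ℕ → List α) :
    (List.range (a + b)).flatMap g =
      (List.range a).flatMap g ++ (List.range b).flatMap fun i => g (a + i) := by
  rw [List.range_add, List.flatMap_append, List.flatMap_map]

theorem List.flatMap_range_const {α : Type} (a : ℕ) (g : ℕ → List α) (l : List α)
    (h : ∀ i < a, g i = l) : (List.range a).flatMap g = (List.replicate a l).flatten := by
  rw [List.flatMap_def]
  congr 1
  refine List.eq_replicate_iff.2 ⟨by simp, fun x hx => ?_⟩
  simp only [List.mem_map, List.mem_range] at hx
  obtain ⟨i, hi, rfl⟩ := hx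
  exact h i hi

theorem List.ofFn_flatten_eq_flatMap_range {α : Type} (a : ℕ) (g : ℕ → List α) :
    (List.ofFn fun i : Fin a => g i).flatten = (List.range a).flatMap g := by
  rw [List.flatMap_def, List.ofFn_eq_map, ← List.map_coe_finRange_eq_range, List.map_map]
  rfl

namespace NumberCoding

variable (e : NumberCoding)

theorem encodeRow_append (l l' : List ℤ) :
    e.encodeRow (l ++ l') = e.encodeRow l ++ e.encodeRow l' :=
  List.flatMap_append

theorem encodeRow_flatMap {α : Type} (l : List α) (g : α → List ℤ) :
    e.encodeRow (l.flatMap g) = l.flatMap fun x => e.encodeRow (g x) :=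
  List.flatMap_assoc

theorem encodeBlock_flatMap {α : Type} (l : List α) (g : α → List (List ℤ)) :
    e.encodeBlock (l.flatMap g) = l.flatMap fun x => e.encodeBlock (g x) :=
  List.flatMap_assoc

end NumberCoding

/-! ### Token distributions as integer vectors -/

instance : Finite HeadMove :=
  Finite.of_injective (fun m : HeadMove => (⟨m.toNat, Nat.lt_succ_of_le m.toNat_le⟩ : Fin 3))
    fun a b h => by cases a <;> cases b <;> simp_all [HeadMove.toNat]

namespace NTM

variable {Γ : Type} {M : NTM Γ}

attribute [instance] NTM.finState NTM.finSym

instance : Finite M.Tile := by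
  let f : M.Tile → M.Sym ⊕ M.Sym ⊕ (M.Sym × M.State × M.Sym × M.State × HeadMove) ⊕ M.State
    | .idle s => .inl s
    | .erase s => .inr (.inl s)
    | .act s q s' q' m => .inr (.inr (.inl (s, q, s', q', m)))
    | .acc q => .inr (.inr (.inr q))
  refine Finite.of_injective f fun a b h => ?_
  cases a <;> cases b <;> simp_all [f]

variable (M)

/-- The number of kinds of tokens. -/
noncomputable def numTokens : ℕ := Nat.card (M.Sym ⊕ M.State)

/-- The number of valid moves. -/
noncomputable def numTiles : ℕ := Nat.card {τ : M.Tile // τ.Valid}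

/-- An enumeration of the kinds of tokens. -/
noncomputable def tokenEquiv : M.Sym ⊕ M.State ≃ Fin M.numTokens := Finite.equivFin _

/-- An enumeration of the valid moves. -/
noncomputable def tileEquiv : {τ : M.Tile // τ.Valid} ≃ Fin M.numTiles := Finite.equivFin _

noncomputable instance : Fintype {τ : M.Tile // τ.Valid} := Fintype.ofFinite _

theorem numTokens_pos : 0 < M.numTokens :=
  have : Nonempty (M.Sym ⊕ M.State) := ⟨.inl M.blank⟩
  Nat.card_pos

variable {M}

/-- Block `b` of a vector contains the symbols of cell `b - 1` and the heads of cell `b`. -/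
def block (v : ℕ → M.Sym ⊕ M.State → ℤ) (b : ℕ) : M.Sym ⊕ M.State → ℤ
  | .inl s => if b = 0 then 0 else v (b - 1) (.inl s)
  | .inr q => v b (.inr q)

/-- The vector with the first `D` blocks of `v`. -/
noncomputable def toVec (D : ℕ) (v : ℕ → M.Sym ⊕ M.State → ℤ) (x : Fin (D * M.numTokens)) : ℤ :=
  block v (finProdFinEquiv.symm x).1 (M.tokenEquiv.symm (finProdFinEquiv.symm x).2)

theorem toVec_add (D : ℕ) (v v' : ℕ → M.Sym ⊕ M.State → ℤ) :
    toVec D (v + v') = toVec D v + toVec D v' := by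
  funext x
  simp only [toVec, Pi.add_apply]
  cases M.tokenEquiv.symm (finProdFinEquiv.symm x).2 with
  | inl s => simp only [block, Pi.add_apply]; split_ifs <;> simp
  | inr q => simp [block]

theorem toVec_zero (D : ℕ) : toVec D (0 : ℕ → M.Sym ⊕ M.State → ℤ) = 0 := by
  funext x
  simp only [toVec, Pi.zero_apply]
  cases M.tokenEquiv.symm (finProdFinEquiv.symm x).2 <;> simp [block]

theorem toVec_apply (D : ℕ) (v : ℕ → M.Sym ⊕ M.State → ℤ) (i : Fin D) (c : M.Sym ⊕ M.State) :
    toVec D v (finProdFinEquiv (i, M.tokenEquiv c)) = block v i c := by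
  simp [toVec]

/-- The number of blocks. -/
def numBlocks (V U : ℕ) : ℕ := U * (V + 3) + (V + 4)

variable (M) in
theorem dim_pos (V U : ℕ) : 0 < numBlocks V U * M.numTokens :=
  Nat.mul_pos (by unfold numBlocks; omega) M.numTokens_pos

variable (M) in
/-- The vectors of the moves of the first `U * (V + 3)` cells. -/
noncomputable def letters (V U : ℕ) (a : Fin (U * (V + 3) * M.numTiles)) :
    Fin (numBlocks V U * M.numTokens) → ℤ :=
  toVec _ ((M.tileEquiv.symm (finProdFinEquiv.symm a).2).1.effect V (finProdFinEquiv.symm a).1)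

/-- From left to right, the letter counts are regrouped by cell and `acceptsIn_of_tokensBefore`
applies. From right to left, `toVec` is additive and so maps every `Fire` to a step. -/
theorem reaches_iff {V U : ℕ} {w : List Γ} {T : ℕ} (hU : U = T + 1) (hV : 2 * U ≤ V) :
    (ZVAS.ofVectors (M.dim_pos V U) (M.letters V U)).Reaches
      (ZVAS.cfg _ _ (toVec _ (M.initTokens V U w))) (ZVAS.cfg _ _ 0) ↔ M.AcceptsIn w T := by
  constructor
  · intro h
    obtain ⟨n, hn⟩ := ZVAS.exists_count_of_reaches h
    replace hn : (0 : Fin (numBlocks V U * M.numTokens) → ℤ) =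
      toVec _ (M.initTokens V U w) + ∑ a, (n a : ℤ) • M.letters V U a := hn
    let n' : ℕ → {τ : M.Tile // τ.Valid} → ℕ := fun j τ =>
      if hj : j < U * (V + 3) then n (finProdFinEquiv (⟨j, hj⟩, M.tileEquiv τ)) else 0
    have hsum : ∀ i < numBlocks V U, ∀ c,
        block (tokensBefore V n' (M.initTokens V U w) (U * (V + 3))) i c = 0 := by
      intro i hi c
      have h1 := congrFun hn (finProdFinEquiv (⟨i, hi⟩, M.tokenEquiv c))
      rw [Pi.zero_apply, Pi.add_apply, toVec_apply, Finset.sum_apply,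
        ← finProdFinEquiv.sum_comp, Fintype.sum_prod_type] at h1
      simp only [Pi.smul_apply, letters, Equiv.symm_apply_apply, toVec_apply] at h1
      have h2 : ∀ j : Fin (U * (V + 3)), ∑ l : Fin M.numTiles, (n (finProdFinEquiv (j, l)) : ℤ) •
          block ((M.tileEquiv.symm l).1.effect V j) i c = block (cellEffect V n' j) i c := by
        intro j
        rw [← M.tileEquiv.sum_comp]
        cases c with
        | inl s =>
          simp only [block, cellEffect]
          split_ifs
          · simp
          · simp [n']
        | inr q => simp [block, cellEffect, n']
      simp only [h2] at h1
      rw [← Finset.sum_range (fun j => block (cellEffect V n' j) i c)] at h1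
      rw [h1]
      cases c with
      | inl s =>
        simp only [block, tokensBefore]
        split_ifs <;> simp
      | inr q => simp [block, tokensBefore]
    -- The largest head cell needed, `U * (V + 3) + (V + 3)`, is the index of the last block;
    -- symbols of cell `i` are found in block `i + 1`.
    refine acceptsIn_of_tokensBefore (n := n') hU hV ?_ ?_
    · intro i hi d
      cases d with
      | inl s =>
        have := hsum (i + 1) (by unfold numBlocks; omega) (.inl s)
        simpa [block] using this
      | inr q => exact hsum i (by unfold numBlocks; omega) (.inr q)
    · intro i hi q
      exact hsum i (by unfold numBlocks; omega) (.inr q)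
  · intro h
    have h1 := reaches_zero_of_acceptsIn hV (by omega) h
    rw [← toVec_zero]
    refine Relation.ReflTransGen.lift
      (f := fun v => ZVAS.cfg (M.dim_pos V U) (M.letters V U) (toVec _ v)) (h := ?_) _ _ h1
    rintro v _ ⟨j, hj, τ, hτ, rfl⟩
    have h2 := ZVAS.reaches_add (hd := M.dim_pos V U) (b := M.letters V U) (toVec _ v)
      (finProdFinEquiv (⟨j, hj⟩, M.tileEquiv ⟨τ, hτ⟩))
    rw [show M.letters V U (finProdFinEquiv (⟨j, hj⟩, M.tileEquiv ⟨τ, hτ⟩)) =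
      toVec _ (τ.effect V j) by simp [letters], ← toVec_add] at h2
    exact h2

end NTM

/-! ## The words of the instances -/

theorem List.flatMap_eq_flatMap_range {α β : Type} (w : List α) (f : α → List β) :
    w.flatMap f = (List.range w.length).flatMap fun i => (w[i]?).toList.flatMap f := by
  induction w with
  | nil => rfl
  | cons a w ih =>
    rw [List.flatMap_cons, ih, List.length_cons, List.range_succ_eq_map, List.flatMap_cons,
      List.flatMap_map]
    simp

namespace NTM

variable {Γ : Type} {M : NTM Γ} (e : NumberCoding)

/-- The word of one block of a vector. -/
noncomputable def blockWord (x : M.Sym ⊕ M.State → ℤ) : List CodeSym :=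
  e.encodeRow (List.ofFn fun c => x (M.tokenEquiv.symm c))

theorem encodeRow_toVec (D : ℕ) (v : ℕ → M.Sym ⊕ M.State → ℤ) :
    e.encodeRow (List.ofFn (toVec D v)) =
      (List.range D).flatMap fun b => blockWord e (block v b) := by
  unfold toVec
  rw [List.ofFn_finProdFinEquiv fun p : Fin D × Fin M.numTokens =>
      block v p.1 (M.tokenEquiv.symm p.2),
    List.ofFn_flatten_eq_flatMap_range D fun i => List.ofFn fun c =>
      block v i (M.tokenEquiv.symm c), e.encodeRow_flatMap]
  rfl

variable (M) in
/-- The word of `k` blocks of zeros. -/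
noncomputable def zeroWord (k : ℕ) : List CodeSym :=
  (List.replicate k (blockWord e (0 : M.Sym ⊕ M.State → ℤ))).flatten

theorem flatMap_blockWord_zero {k : ℕ} {g : ℕ → M.Sym ⊕ M.State → ℤ} (h : ∀ i < k, g i = 0) :
    (List.range k).flatMap (fun i => blockWord e (g i)) = zeroWord M e k :=
  List.flatMap_range_const k _ _ fun i hi => by rw [h i hi]

theorem block_zero (b : ℕ) : block (0 : ℕ → M.Sym ⊕ M.State → ℤ) b = 0 := by
  funext c
  cases c <;> simp [block]

theorem encodeRow_zero (D : ℕ) :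
    e.encodeRow (List.ofFn (0 : Fin (D * M.numTokens) → ℤ)) = zeroWord M e D := by
  rw [← toVec_zero, encodeRow_toVec]
  exact flatMap_blockWord_zero e fun i _ => block_zero i

/-- The word of the blocks from which a move takes its tokens. -/
noncomputable def usesWord (τ : M.Tile) : List CodeSym :=
  (List.range 2).flatMap fun i => blockWord e (block (τ.effect 0 0) i)

/-- The word of the blocks to which a move gives its tokens. -/
noncomputable def givesWord (τ : M.Tile) : List CodeSym :=
  (List.range 3).flatMap fun i => blockWord e (block (τ.effect 0 0) (2 + i))

theorem effect_eq_zero {V j i : ℕ} (τ : M.Tile) (h1 : i < j + V + 2) (h2 : i ≠ j) :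
    τ.effect V j i = 0 := by
  funext c
  simp [Tile.effect, Tile.gives_of_lt τ h1, h2]

theorem effect_self (V j : ℕ) (τ : M.Tile) : τ.effect V j j = τ.effect 0 0 0 := by
  funext c
  simp [Tile.effect, Tile.gives_of_lt τ (show j < j + V + 2 by omega),
    Tile.gives_of_lt τ (show 0 < 0 + 0 + 2 by omega)]

/-- The cells receiving tokens depend on `V` and `j` only through `j + V`. So the nonzero parts of a
row are words depending on the move alone, which a program can contain literally. -/
theorem effect_shift (V j i : ℕ) (τ : M.Tile) :
    τ.effect V j (j + V + (i + 1)) = τ.effect 0 0 (i + 1) := by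
  funext c
  have h0 : j + V + (i + 1) ≠ j := by omega
  simp only [Tile.effect, h0, if_false, Nat.succ_ne_zero, sub_zero]
  cases τ with
  | erase => rfl
  | acc => rfl
  | idle s =>
    simp only [Tile.gives]
    congr 1
    simp only [eq_iff_iff]
    exact and_congr (by omega) Iff.rfl
  | act s q s' q' m =>
    simp only [Tile.gives]
    congr 2
    · simp only [eq_iff_iff]
      exact and_congr (by omega) Iff.rfl
    · simp only [eq_iff_iff]
      exact and_congr (by omega) Iff.rfl

theorem effect_of_gt {V j i : ℕ} (τ : M.Tile) (h : j + V + 4 < i) : τ.effect V j i = 0 := by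
  funext c
  have h0 : i ≠ j := by omega
  have h1 : i ≠ j + (V + 3) := by omega
  cases τ with
  | act s q s' q' m =>
    have := m.toNat_le
    have h2 : i ≠ j + V + 2 + m.toNat := by omega
    simp [Tile.effect, Tile.gives, h0, h1, h2]
  | _ => simp [Tile.effect, Tile.gives, h0, h1]

theorem effect_inl {V j i : ℕ} (τ : M.Tile) (s : M.Sym) (h : j + V + 3 < i) :
    τ.effect V j i (.inl s) = 0 := by
  rw [Tile.effect, Tile.gives_inl_of_ne τ (by omega), if_neg (by omega), sub_zero]

/-- A head is taken from block `j` and a symbol from block `j + 1`; a head is given to one of the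
blocks `j + V + 2`, `j + V + 3`, `j + V + 4` and a symbol to block `j + V + 4`. The other blocks are
`j`, `V` and `y` blocks of zeros. -/
theorem encodeRow_effect {V U j y : ℕ} (τ : M.Tile) (hy : j + 1 + y = U * (V + 3)) :
    e.encodeRow (List.ofFn (toVec (numBlocks V U) (τ.effect V j))) =
      zeroWord M e j ++ (usesWord e τ ++ (zeroWord M e V ++ (givesWord e τ ++ zeroWord M e y))) := by
  rw [encodeRow_toVec, show numBlocks V U = j + (2 + (V + (3 + y))) by unfold numBlocks; omega,
    List.flatMap_range_add, List.flatMap_range_add, List.flatMap_range_add,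
    List.flatMap_range_add]
  congr 1
  · refine flatMap_blockWord_zero e fun i hi => ?_
    funext c
    cases c with
    | inl s =>
      simp only [block, effect_eq_zero τ (show i - 1 < j + V + 2 by omega)
        (show i - 1 ≠ j by omega), Pi.zero_apply, ite_self]
    | inr q =>
      simp only [block, effect_eq_zero τ (show i < j + V + 2 by omega) (show i ≠ j by omega),
        Pi.zero_apply]
  congr 1
  · refine List.flatMap_congr fun i hi => ?_
    congr 1
    funext c
    have : i = 0 ∨ i = 1 := by simp at hi; omega
    rcases this with rfl | rfl
    · cases c with
      | inl s =>
        simp only [block, if_true, add_zero]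
        split_ifs with hj
        · rfl
        · rw [effect_eq_zero τ (by omega) (by omega)]
          rfl
      | inr q => simp only [block, add_zero, effect_self]
    · cases c with
      | inl s => simp only [block, Nat.add_sub_cancel, effect_self]; simp
      | inr q =>
        simp only [block]
        rw [effect_eq_zero τ (by omega) (by omega), effect_eq_zero τ (by omega) (by omega)]
  congr 1
  · refine flatMap_blockWord_zero e fun i hi => ?_
    funext c
    cases c with
    | inl s =>
      simp only [block]
      rw [effect_eq_zero τ (by omega) (by omega)]
      simp
    | inr q =>
      simp only [block]
      rw [effect_eq_zero τ (by omega) (by omega)]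
  congr 1
  · refine List.flatMap_congr fun i hi => ?_
    congr 1
    funext c
    cases c with
    | inl s =>
      simp only [block]
      rw [if_neg (by omega), if_neg (by omega),
        show j + (2 + (V + i)) - 1 = j + V + (i + 1) by omega, effect_shift,
        show 2 + i - 1 = i + 1 by omega]
    | inr q =>
      simp only [block]
      rw [show j + (2 + (V + i)) = j + V + (i + 1 + 1) by omega, effect_shift,
        show 2 + i = i + 1 + 1 by omega]
  · refine flatMap_blockWord_zero e fun i hi => ?_
    funext c
    cases c with
    | inl s =>
      simp only [block]
      rw [if_neg (by omega), effect_inl τ s (by omega)]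
      rfl
    | inr q =>
      simp only [block]
      rw [effect_of_gt τ (by omega)]

/-- The row of a move of cell `j`, where `y` is the number of cells with moves after `j`. -/
noncomputable def moveWord (V j y : ℕ) (τ : {τ : M.Tile // τ.Valid}) : List CodeSym :=
  e.encodeRow [1] ++ (zeroWord M e j ++ (usesWord e τ.1 ++ (zeroWord M e V ++
    (givesWord e τ.1 ++ (zeroWord M e y ++ [CodeSym.semicolon])))))

variable (M) in
/-- The list of all valid moves. -/
noncomputable def tiles : List {τ : M.Tile // τ.Valid} := List.ofFn M.tileEquiv.symm

variable (M) in
/-- The rows of the moves of the cells before `j`, where `J` is the number of cells with moves. -/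
noncomputable def rowsWord (V J j : ℕ) : List CodeSym :=
  (List.range j).flatMap fun j => M.tiles.flatMap fun τ => moveWord e V j (J - 1 - j) τ

theorem encodeBlock_rows (V U : ℕ) :
    e.encodeBlock (ZVAS.ofVectors (M.dim_pos V U) (M.letters V U)).rows =
      rowsWord M e V (U * (V + 3)) (U * (V + 3)) := by
  rw [ZVAS.rows_ofVectors]
  unfold letters
  rw [List.ofFn_finProdFinEquiv fun p : Fin (U * (V + 3)) × Fin M.numTiles =>
      (1 : ℤ) :: List.ofFn (toVec (numBlocks V U) ((M.tileEquiv.symm p.2).1.effect V p.1)),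
    List.ofFn_flatten_eq_flatMap_range (U * (V + 3)) fun j => List.ofFn fun l : Fin M.numTiles =>
      (1 : ℤ) :: List.ofFn (toVec (numBlocks V U) ((M.tileEquiv.symm l).1.effect V j)),
    e.encodeBlock_flatMap, rowsWord]
  refine List.flatMap_congr fun j hj => ?_
  rw [List.mem_range] at hj
  have h1 : (List.ofFn fun l : Fin M.numTiles =>
      (1 : ℤ) :: List.ofFn (toVec (numBlocks V U) ((M.tileEquiv.symm l).1.effect V j))) =
      M.tiles.flatMap fun τ => [(1 : ℤ) :: List.ofFn (toVec (numBlocks V U) (τ.1.effect V j))] := by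
    rw [tiles, ← List.map_eq_flatMap, List.map_ofFn]
    rfl
  rw [h1, e.encodeBlock_flatMap]
  refine List.flatMap_congr fun τ _ => ?_
  simp only [NumberCoding.encodeBlock, List.flatMap_cons, List.flatMap_nil, List.append_nil]
  rw [← List.singleton_append, e.encodeRow_append,
    encodeRow_effect e τ.1 (show j + 1 + (U * (V + 3) - 1 - j) = _ by omega), moveWord]
  simp only [List.append_assoc]

/-! ### The word of the initial configuration -/

open Classical in
/-- The symbol `s` and no head. -/
noncomputable def symBlock (s : M.Sym) : M.Sym ⊕ M.State → ℤ
  | .inl s' => if s' = s then 1 else 0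
  | .inr _ => 0

variable (M) in
open Classical in
/-- The blank symbol and the head in the initial state. -/
noncomputable def startBlock : M.Sym ⊕ M.State → ℤ
  | .inl s => if s = M.blank then 1 else 0
  | .inr q => if q = M.start then 1 else 0

variable (M) in
/-- The word of `k` blank cells. -/
noncomputable def blankWord (k : ℕ) : List CodeSym :=
  (List.replicate k (blockWord e (symBlock M.blank))).flatten

variable (M) in
/-- The word of the initial configuration. -/
noncomputable def sourceWord (U J : ℕ) (w : List Γ) : List CodeSym :=
  zeroWord M e 1 ++ (blankWord M e U ++ (blockWord e M.startBlock ++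
    (w.flatMap (fun a => blockWord e (symBlock (M.input a))) ++ (blankWord M e (U + 2) ++ zeroWord M e J))))

theorem block_initTokens {V U b i : ℕ} {w : List Γ} (hb : b = i + 1) (hi : i < V + 3) (hU : i ≠ U) :
    block (M.initTokens V U w) b =
      symBlock (M.inputTape w ((i : ℤ) - (U + 1))) := by
  subst hb
  funext c
  cases c with
  | inl s =>
    simp only [block, initTokens, symTokens, headToken, symBlock, Nat.succ_ne_zero, if_false,
      Nat.add_sub_cancel, cellPos, Pi.add_apply, add_zero]
    congr 1
    simp [hi, Nat.mod_eq_of_lt hi]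
  | inr q => simp [block, initTokens, symTokens, headToken, hU, symBlock]

/-- The `V + 3` cells of the first row are `U + 1` blanks, the input, and `U + 2` blanks. -/
theorem encodeRow_initTokens {V U : ℕ} {w : List Γ} (hV : V = 2 * U + w.length) :
    e.encodeRow (List.ofFn (toVec (numBlocks V U) (M.initTokens V U w))) =
      sourceWord M e U (U * (V + 3)) w := by
  rw [encodeRow_toVec, sourceWord,
    show numBlocks V U = 1 + (U + (1 + (w.length + (U + 2 + U * (V + 3))))) by
      unfold numBlocks; omega,
    List.flatMap_range_add, List.flatMap_range_add, List.flatMap_range_add,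
    List.flatMap_range_add, List.flatMap_range_add]
  congr 1
  · refine flatMap_blockWord_zero e fun i hi => ?_
    obtain rfl : i = 0 := by omega
    funext c
    cases c <;> simp [block, initTokens, symTokens, headToken]
  congr 1
  · refine List.flatMap_range_const _ _ _ fun i hi => ?_
    rw [block_initTokens (add_comm 1 i) (by omega) (by omega), inputTape,
      if_neg (show ¬ (0 : ℤ) ≤ i - (U + 1) by omega)]
  congr 1
  -- The block with the head in cell `U + 1` carries the symbol of cell `U`, at position `-1`, which
  -- is blank for every input. Thanks to the shift between symbols and heads, this block does not
  -- depend on the first letter.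
  · simp only [List.range_one, List.flatMap_cons, List.flatMap_nil, List.append_nil]
    congr 1
    funext c
    cases c with
    | inl s =>
      have h1 : U < V + 3 := by omega
      have h2 : M.inputTape w ((U : ℤ) - (U + 1)) = M.blank := by
        rw [inputTape, if_neg (by omega)]
      simp only [block, initTokens, symTokens, headToken, cellPos, startBlock, Nat.add_comm 1 U,
        add_zero, Nat.add_sub_cancel, Nat.succ_ne_zero, if_false, Pi.add_apply]
      congr 1
      rw [Nat.mod_eq_of_lt h1, h2]
      simp [h1]
    | inr q =>
      simp only [block, initTokens, symTokens, headToken, startBlock, Nat.add_comm 1 U, add_zero,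
        Pi.add_apply, zero_add]
      congr 1
      simp
  congr 1
  · rw [List.flatMap_eq_flatMap_range w]
    refine List.flatMap_congr fun i hi => ?_
    rw [List.mem_range] at hi
    rw [block_initTokens (i := U + 1 + i) (by omega) (by omega) (by omega),
      show ((U + 1 + i : ℕ) : ℤ) - (U + 1) = i by push_cast; ring, inputTape,
      if_pos (by omega), Int.toNat_natCast, List.getElem?_eq_getElem hi]
    simp
  congr 1
  · refine List.flatMap_range_const _ _ _ fun i hi => ?_
    rw [block_initTokens (i := U + 1 + w.length + i) (by omega) (by omega) (by omega),
      show ((U + 1 + w.length + i : ℕ) : ℤ) - (U + 1) = (w.length + i : ℕ) by push_cast; ring,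
      inputTape, if_pos (by omega), Int.toNat_natCast, List.getElem?_eq_none (by omega)]
    rfl
  · refine flatMap_blockWord_zero e fun i hi => ?_
    funext c
    cases c with
    | inl s =>
      simp only [block, initTokens, symTokens, headToken, Pi.add_apply]
      rw [if_neg (by omega), if_neg (by omega)]
      rfl
    | inr q =>
      simp only [block, initTokens, symTokens, headToken, Pi.add_apply]
      rw [if_neg (by omega)]
      rfl

end NTM

/-! ## Programs with counters -/

namespace StackProg

/-- The counters of the programs below. -/
inductive Counter where
  | len
  | clock
  | gap
  | left
  | right
  | tmp
  | tmp'
  deriving DecidableEq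

instance : Fintype Counter :=
  ⟨{.len, .clock, .gap, .left, .right, .tmp, .tmp'}, fun x => by cases x <;> simp⟩

/-- The stacks of the programs below. -/
inductive Stack where
  | inp
  | rev
  | out
  | cnt (k : Counter)
  deriving DecidableEq, Fintype

open Stack Counter

/-- The alphabets of the stacks. -/
def Alph (Γ : Type) : Stack → Type
  | inp => Γ
  | rev => Γ
  | out => CodeSym
  | cnt _ => Unit

instance {Γ : Type} [Finite Γ] : ∀ k, Finite (Alph Γ k)
  | inp => inferInstanceAs (Finite Γ)
  | rev => inferInstanceAs (Finite Γ)
  | out => inferInstanceAs (Finite CodeSym)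
  | cnt _ => inferInstanceAs (Finite Unit)

variable {Γ : Type}

/-- The stacks with given contents. -/
def store (i r : List Γ) (o : List CodeSym) (c : Counter → ℕ) : ∀ k, List (Alph Γ k)
  | inp => i
  | rev => r
  | out => o
  | cnt k => List.replicate (c k) ()

theorem update_cnt (i r : List Γ) (o : List CodeSym) (c : Counter → ℕ) (k : Counter) (m : ℕ) :
    Function.update (store i r o c) (cnt k) (List.replicate m ()) =
      store i r o (Function.update c k m) := by
  funext j
  rcases j with _ | _ | _ | j
  · rfl
  · rfl
  · rfl
  · by_cases h : j = k
    · subst h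
      simp [store]
    · rw [Function.update_of_ne (by simpa using h)]
      simp [store, h]

theorem update_inp (i i' r : List Γ) (o : List CodeSym) (c : Counter → ℕ) :
    Function.update (store i r o c) inp i' = store i' r o c := by
  funext j
  cases j <;> rfl

theorem update_rev (i r r' : List Γ) (o : List CodeSym) (c : Counter → ℕ) :
    Function.update (store i r o c) rev r' = store i r' o c := by
  funext j
  cases j <;> rfl

theorem update_out (i r : List Γ) (o o' : List CodeSym) (c : Counter → ℕ) :
    Function.update (store i r o c) out o' = store i r o' c := by
  funext j
  cases j <;> rfl

/-- Add the symbols `l` to the output, in front. -/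
def write (l : List CodeSym) : StackProg (Alph Γ) := .emit out l

/-- Add `a` to the counter `k`. -/
def incr (k : Counter) (a : ℕ) : StackProg (Alph Γ) := .emit (cnt k) (List.replicate a ())

/-- Decrease the counter `k` to zero and execute `P` each time. -/
def count (k : Counter) (P : StackProg (Alph Γ)) : StackProg (Alph Γ) := .loop (cnt k) fun _ => P

/-- Execute `P` as many times as the counter `k` tells. The counter `t` has to be zero. -/
def rep (k t : Counter) (P : StackProg (Alph Γ)) : StackProg (Alph Γ) :=
  .seq (count k (incr t 1)) (count t (.seq (incr k 1) P))

variable {i r : List Γ} {o : List CodeSym} {c : Counter → ℕ}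

theorem exec_write (l : List CodeSym) :
    Exec (write l) (store i r o c) (store i r (l ++ o) c) 1 := by
  have h := Exec.emit out l (store i r o c)
  have e : Function.update (store i r o c) out (List.append l (store i r o c out)) =
      store i r (l ++ o) c := update_out i r o (l ++ o) c
  exact e ▸ h

theorem exec_incr (k : Counter) (a : ℕ) :
    Exec (incr k a) (store i r o c) (store i r o (Function.update c k (c k + a))) 1 := by
  have h := Exec.emit (cnt k) (List.replicate a ()) (store i r o c)
  have e : (List.append (List.replicate a ()) (List.replicate (c k) ()) : List Unit) =
      List.replicate (c k + a) () := by
    rw [List.append_eq, List.replicate_append_replicate, add_comm]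
  have e' : Function.update (store i r o c) (cnt k)
      (List.append (List.replicate a ()) (store i r o c (cnt k))) =
        store i r o (Function.update c k (c k + a)) :=
    (congrArg (Function.update (store i r o c) (cnt k)) e).trans (update_cnt ..)
  exact e' ▸ h

/-- `O j` and `C j` describe the state after `j` rounds. The entry of `k` in `C j` is overwritten by
the number of rounds left, which `P` must preserve. -/
theorem exec_count {P : StackProg (Alph Γ)} {k : Counter} (b m : ℕ) (O : ℕ → List CodeSym)
    (C : ℕ → Counter → ℕ)
    (hP : ∀ j < m, Exec P (store i r (O j) (Function.update (C j) k (m - j - 1)))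
      (store i r (O (j + 1)) (Function.update (C (j + 1)) k (m - (j + 1)))) b) :
    Exec (count k P) (store i r (O 0) (Function.update (C 0) k m))
      (store i r (O m) (Function.update (C m) k 0)) (m * (b + 1) + 1) := by
  have := Exec.loop (k := cnt k) (body := fun _ => P) b m
    (fun j => store i r (O j) (Function.update (C j) k (m - j))) (fun j hj => by
      refine ⟨(), List.replicate (m - j - 1) (), ?_, ?_⟩
      · have : m - j = m - j - 1 + 1 := by omega
        simp only [store, Function.update_self]
        rw [this]
        rfl
      · rw [update_cnt, Function.update_idem]
        exact hP j hj) (by simp [store])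
  simp only [Nat.sub_zero, Nat.sub_self] at this
  exact this

theorem exec_move {k k' : Counter} (h : k' ≠ k) (a : ℕ) :
    Exec (count k (incr k' a)) (store i r o c)
      (store i r o (Function.update (Function.update c k' (c k' + c k * a)) k 0))
      (c k * 2 + 1) := by
  have := exec_count (i := i) (r := r) (k := k) (P := incr k' a) 1 (c k) (fun _ => o)
    (fun j => Function.update c k' (c k' + j * a)) (fun j hj => by
      convert exec_incr k' a using 2
      funext x
      by_cases h1 : x = k
      · subst h1
        simp [h, h.symm, Nat.sub_sub]
      · by_cases h2 : x = k'
        · subst h2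
          simp [h1]
          ring
        · simp [h1, h2])
  simpa using this

/-- The number of steps of `m` repetitions of a program with at most `b` steps. -/
def repCost (m b : ℕ) : ℕ := m * 2 + 1 + (m * (1 + b + 1) + 1)

/-- A loop destroys its counter, so `k` is first moved to `t` and then restored round by round.
During `P` the two counters hold intermediate values, whence the quantification over `x` and `y`. -/
theorem exec_rep {P : StackProg (Alph Γ)} {k t : Counter} (hkt : k ≠ t) (b m : ℕ)
    (O : ℕ → List CodeSym) (C : ℕ → Counter → ℕ) (hk : ∀ j, C j k = m) (ht : ∀ j, C j t = 0)
    (hP : ∀ j < m, ∀ x y,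
      Exec P (store i r (O j) (Function.update (Function.update (C j) k x) t y))
        (store i r (O (j + 1)) (Function.update (Function.update (C (j + 1)) k x) t y)) b) :
    Exec (rep k t P) (store i r (O 0) (C 0)) (store i r (O m) (C m)) (repCost m b) := by
  have h1 := exec_move (i := i) (r := r) (o := O 0) (c := C 0) hkt.symm 1
  rw [hk, ht] at h1
  have h2 := exec_count (i := i) (r := r) (k := t) (P := .seq (incr k 1) P) (1 + b) m O
    (fun j => Function.update (C j) k j) (fun j hj => by
      refine Exec.seq (S' := store i r (O j)
        (Function.update (Function.update (C j) k (j + 1)) t (m - (j + 1)))) ?_ (hP j hj _ _)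
      convert exec_incr k 1 using 2
      funext x
      grind [Function.update_apply])
  refine Exec.seq h1 ?_
  convert h2 using 2
  · funext x
    grind [Function.update_apply]
  · funext x
    grind [Function.update_apply]

theorem exec_rep_write {k t : Counter} (hkt : k ≠ t) (l : List CodeSym) (ht : c t = 0) :
    Exec (rep k t (write l)) (store i r o c)
      (store i r ((List.replicate (c k) l).flatten ++ o) c) (repCost (c k) 1) := by
  have := exec_rep (i := i) (r := r) (P := write l) hkt 1 (c k)
    (fun j => (List.replicate j l).flatten ++ o) (fun _ => c) (fun _ => rfl) (fun _ => ht)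
    (fun j _ x y => by
      simp only [List.replicate_succ, List.flatten_cons, List.append_assoc]
      exact exec_write l)
  simpa using this

theorem exec_rep_incr {k t k' : Counter} (hkt : k ≠ t) (hk : k' ≠ k) (ht' : k' ≠ t) (a : ℕ)
    (ht : c t = 0) :
    Exec (rep k t (incr k' a)) (store i r o c)
      (store i r o (Function.update c k' (c k' + c k * a))) (repCost (c k) 1) := by
  have := exec_rep (i := i) (r := r) (P := incr k' a) hkt 1 (c k) (fun _ => o)
    (fun j => Function.update c k' (c k' + j * a)) (fun _ => by simp [hk.symm])
    (fun _ => by simp [ht'.symm, ht]) (fun j _ x y => by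
      convert exec_incr k' a using 2
      funext z
      grind [Function.update_apply])
  simpa using this

/-- Every polynomial can be evaluated in polynomial time. -/
theorem exists_eval (Γ : Type) (p : Polynomial ℕ) :
    ∃ (P : StackProg (Alph Γ)) (q : Polynomial ℕ), ∀ (i r : List Γ) (o : List CodeSym)
      (c : Counter → ℕ), c clock = 0 → c tmp = 0 → c tmp' = 0 →
        Exec P (store i r o c) (store i r o (Function.update c clock (p.eval (c len))))
          (q.eval (c len)) := by
  induction p using Polynomial.recOnHorner with
  | M0 =>
    refine ⟨incr clock 0, 1, fun i r o c h _ _ => ?_⟩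
    convert exec_incr clock 0 using 2
    · simp [h]
    · simp
  | MC p a _ _ ih =>
    obtain ⟨P, q, h⟩ := ih
    refine ⟨.seq P (incr clock a), q + 1, fun i r o c h0 h1 h2 => ?_⟩
    rw [Polynomial.eval_add, Polynomial.eval_add, Polynomial.eval_one, Polynomial.eval_C]
    refine (h i r o c h0 h1 h2).seq ?_
    convert exec_incr clock a using 2
    simp
  | MX p _ ih =>
    obtain ⟨P, q, h⟩ := ih
    -- This is `repCost n 1` as a polynomial in `n`.
    let cost : Polynomial ℕ := Polynomial.X * 2 + 1 + (Polynomial.X * 3 + 1)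
    refine ⟨.seq P (.seq (count clock (rep len tmp (incr tmp' 1))) (count tmp' (incr clock 1))),
      q + (p * (cost + 1) + 1 + (p * Polynomial.X * 2 + 1)), fun i r o c h0 h1 h2 => ?_⟩
    rw [Polynomial.eval_add, Polynomial.eval_add]
    -- Horner step: the product of the old value and `len` is collected in `tmp'` while `clock` is
    -- emptied, then moved back to `clock`.
    refine (h i r o c h0 h1 h2).seq (Exec.seq
      (S' := store i r o (Function.update c tmp' (p.eval (c len) * c len))) ?_ ?_)
    · have := exec_count (i := i) (r := r) (k := clock) (P := rep len tmp (incr tmp' 1))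
        (cost.eval (c len)) (p.eval (c len)) (fun _ => o)
        (fun j => Function.update c tmp' (j * c len)) (fun j hj => by
          have h3 := exec_rep_incr (i := i) (r := r) (o := o) (k := len) (t := tmp) (k' := tmp')
            (c := Function.update (Function.update c tmp' (j * c len)) clock
              (p.eval (c len) - j - 1)) (by decide) (by decide) (by decide) 1 (by simp [h1])
          convert h3 using 2
          · funext z
            by_cases hz : z = tmp'
            · subst hz
              simp
              ring
            · by_cases hz' : z = clock
              · subst hz'
                simp [Nat.sub_sub]
              · simp [hz, hz']
          · simp [cost, repCost])
      convert this using 2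
      · congr 1
        funext z
        by_cases hz : z = tmp'
        · subst hz
          simp [h2]
        · simp [hz]
      · funext z
        by_cases hz : z = clock
        · subst hz
          simp [h0]
        · simp [hz]
      · simp
    · have := exec_move (i := i) (r := r) (o := o)
        (c := Function.update c tmp' (p.eval (c len) * c len)) (k := tmp') (k' := clock)
        (by decide) 1
      convert this using 2
      · funext z
        by_cases hz : z = clock
        · subst hz
          simp [h0]
        · by_cases hz' : z = tmp'
          · subst hz'
            simp [h2]
          · simp [hz, hz']
      · simp

end StackProg

/-! ## The program computing the reduction -/

/-- The functions given by polynomials with natural coefficients. -/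
def IsPolynomial (f : ℕ → ℕ) : Prop := ∃ q : Polynomial ℕ, ∀ n, f n = q.eval n

namespace IsPolynomial

theorem const (a : ℕ) : IsPolynomial fun _ => a := ⟨Polynomial.C a, by simp⟩

theorem id : IsPolynomial fun n => n := ⟨Polynomial.X, by simp⟩

theorem eval (q : Polynomial ℕ) : IsPolynomial fun n => q.eval n := ⟨q, fun _ => rfl⟩

theorem add {f g : ℕ → ℕ} (hf : IsPolynomial f) (hg : IsPolynomial g) :
    IsPolynomial fun n => f n + g n := by
  obtain ⟨p, hp⟩ := hf
  obtain ⟨q, hq⟩ := hg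
  exact ⟨p + q, fun n => by simp [hp, hq]⟩

theorem mul {f g : ℕ → ℕ} (hf : IsPolynomial f) (hg : IsPolynomial g) :
    IsPolynomial fun n => f n * g n := by
  obtain ⟨p, hp⟩ := hf
  obtain ⟨q, hq⟩ := hg
  exact ⟨p * q, fun n => by simp [hp, hq]⟩

theorem repCost {f g : ℕ → ℕ} (hf : IsPolynomial f) (hg : IsPolynomial g) :
    IsPolynomial fun n => StackProg.repCost (f n) (g n) :=
  ((hf.mul (const 2)).add (const 1)).add
    ((hf.mul (((const 1).add hg).add (const 1))).add (const 1))

end IsPolynomial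

namespace StackProg

open Stack Counter NTM

variable {Γ : Type}

/-- The values of the counters. -/
def params (n U V x y : ℕ) : Counter → ℕ
  | len => n
  | clock => U
  | gap => V
  | left => x
  | right => y
  | tmp => 0
  | tmp' => 0

theorem exec_clear {k : Counter} {i r : List Γ} {o : List CodeSym} {c : Counter → ℕ} :
    Exec (count k (write [])) (store i r o c) (store i r o (Function.update c k 0))
      (c k * 2 + 1) := by
  have := exec_count (i := i) (r := r) (k := k) (P := write []) 1 (c k) (fun _ => o)
    (fun _ => c) (fun j _ => exec_write [])
  simpa using this

/-- Reverse and measure the input. -/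
def readInput : StackProg (Alph Γ) :=
  .loop inp fun a => .seq (.emit rev [a]) (incr len 1)

theorem exec_readInput (w r : List Γ) (o : List CodeSym) (m : ℕ) :
    Exec readInput (store w r o (params m 0 0 0 0))
      (store [] (w.reverse ++ r) o (params (m + w.length) 0 0 0 0)) (w.length * 3 + 1) := by
  induction w generalizing r m with
  | nil => exact Exec.loop_nil rfl
  | cons a w ih =>
    have h1 : Exec (.emit rev [a]) (store w r o (params m 0 0 0 0))
        (store w (a :: r) o (params m 0 0 0 0)) 1 :=
      (update_rev w r (a :: r) o (params m 0 0 0 0)) ▸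
        Exec.emit rev [a] (store w r o (params m 0 0 0 0))
    have h2 : Exec (incr len 1) (store w (a :: r) o (params m 0 0 0 0))
        (store w (a :: r) o (params (m + 1) 0 0 0 0)) 1 := by
      convert exec_incr len 1 using 2
      funext k
      cases k <;> rfl
    have h3 := h1.seq h2
    rw [← update_inp (a :: w)] at h3
    have h4 := Exec.loop_cons (k := inp) (body := fun a => .seq (.emit rev [a]) (incr len 1))
      (S := store (a :: w) r o (params m 0 0 0 0)) rfl h3 (ih (a :: r) (m + 1))
    rw [List.reverse_cons, List.append_assoc, List.length_cons, Nat.add_comm w.length,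
      ← Nat.add_assoc]
    exact h4.weaken (by omega)

/-- Compute the parameters of the reduction from the length and the time bound. -/
def computeParams : StackProg (Alph Γ) :=
  .seq (incr clock 1) (.seq (rep len tmp (incr gap 1)) (.seq (rep clock tmp (incr gap 2))
    (rep clock tmp' (.seq (rep gap tmp (incr left 1)) (incr left 3)))))

theorem exec_computeParams (i r : List Γ) (o : List CodeSym) (n U V T : ℕ) (hU : U = T + 1)
    (hV : V = 2 * U + n) :
    Exec computeParams (store i r o (params n T 0 0 0))
      (store i r o (params n U V (U * (V + 3)) 0))
      (1 + (repCost n 1 + (repCost U 1 + repCost U (repCost V 1 + 1)))) := by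
  have h1 : Exec (incr clock 1) (store i r o (params n T 0 0 0))
      (store i r o (params n U 0 0 0)) 1 := by
    convert exec_incr clock 1 using 2
    funext k
    cases k <;> simp [params, hU]
  have h2 : Exec (rep len tmp (incr gap 1)) (store i r o (params n U 0 0 0))
      (store i r o (params n U n 0 0)) (repCost n 1) := by
    convert exec_rep_incr (i := i) (r := r) (o := o) (c := params n U 0 0 0) (k := len) (t := tmp)
      (k' := gap) (by decide) (by decide) (by decide) 1 rfl using 2
    · funext k
      cases k <;> simp [params]
    · rfl
  have h3 : Exec (rep clock tmp (incr gap 2)) (store i r o (params n U n 0 0))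
      (store i r o (params n U V 0 0)) (repCost U 1) := by
    convert exec_rep_incr (i := i) (r := r) (o := o) (c := params n U n 0 0) (k := clock)
      (t := tmp) (k' := gap) (by decide) (by decide) (by decide) 2 rfl using 2
    · funext k
      cases k <;> simp [params, hV]
      omega
    · rfl
  refine h1.seq (h2.seq (h3.seq ?_))
  -- The outer repetition uses `tmp'`, since the inner one needs `tmp`. Each round adds `V + 3` to
  -- `left`.
  have h4 := exec_rep (i := i) (r := r) (P := .seq (rep gap tmp (incr left 1)) (incr left 3))
    (k := clock) (t := tmp') (by decide) (repCost V 1 + 1) U (fun _ => o)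
    (fun j => params n U V (j * (V + 3)) 0) (fun _ => rfl) (fun _ => rfl) (fun j _ x y => by
      refine Exec.seq (exec_rep_incr (by decide) (by decide) (by decide) 1 rfl) ?_
      convert exec_incr left 3 using 2
      funext k
      cases k <;> simp [params]
      ring)
  simpa using h4

/-! ### Programs writing the parts of an instance -/

theorem zeroWord_add {M : NTM Γ} (e : NumberCoding) (a b : ℕ) :
    zeroWord M e (a + b) = zeroWord M e a ++ zeroWord M e b := by
  rw [zeroWord, ← List.replicate_append_replicate, List.flatten_append]
  rfl

theorem blankWord_add {M : NTM Γ} (e : NumberCoding) (a b : ℕ) :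
    blankWord M e (a + b) = blankWord M e a ++ blankWord M e b := by
  rw [blankWord, ← List.replicate_append_replicate, List.flatten_append]
  rfl

variable (M : NTM Γ) (e : NumberCoding)

/-- Write as many blocks of zeros as the counter `k` tells. -/
noncomputable def writeZeros (k : Counter) : StackProg (Alph Γ) :=
  rep k tmp (write (blockWord e (0 : M.Sym ⊕ M.State → ℤ)))

/-- Write the target vector. -/
noncomputable def writeTarget : StackProg (Alph Γ) :=
  .seq (write (zeroWord M e 4)) (.seq (writeZeros M e gap) (writeZeros M e left))

/-- Write the source vector. -/
noncomputable def writeSource : StackProg (Alph Γ) :=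
  .seq (writeZeros M e left) (.seq (write (blankWord M e 2))
    (.seq (rep clock tmp (write (blockWord e (symBlock M.blank))))
      (.seq (.loop rev fun a => write (blockWord e (symBlock (M.input a))))
        (.seq (write (blockWord e M.startBlock))
          (.seq (rep clock tmp (write (blockWord e (symBlock M.blank))))
            (write (zeroWord M e 1)))))))

/-- Write the row of a move. -/
noncomputable def writeMove (τ : {τ : M.Tile // τ.Valid}) : StackProg (Alph Γ) :=
  .seq (write [CodeSym.semicolon]) (.seq (writeZeros M e right) (.seq (write (givesWord e τ.1))
    (.seq (writeZeros M e gap) (.seq (write (usesWord e τ.1)) (.seq (writeZeros M e left)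
      (write (e.encodeRow [1])))))))

/-- Write the rows of the moves in a list. -/
noncomputable def writeMoves : List {τ : M.Tile // τ.Valid} → StackProg (Alph Γ)
  | [] => write []
  | τ :: l => .seq (writeMoves l) (writeMove M e τ)

/-- Write the rows of all moves. -/
noncomputable def writeRows : StackProg (Alph Γ) :=
  .seq (count left (.seq (writeMoves M e M.tiles) (incr right 1))) (count right (incr left 1))

/-- Set all counters to zero. -/
def clearAll : StackProg (Alph Γ) :=
  .seq (count len (write [])) (.seq (count clock (write []))
    (.seq (count gap (write [])) (count left (write []))))

variable {M e} {i r : List Γ} {o : List CodeSym} {n U V J x y : ℕ}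

theorem exec_writeZeros {k : Counter} (h : k ≠ tmp) {c : Counter → ℕ} (hc : c tmp = 0) :
    Exec (writeZeros M e k) (store i r o c) (store i r (zeroWord M e (c k) ++ o) c)
      (repCost (c k) 1) :=
  exec_rep_write h _ hc

theorem exec_writeTarget :
    Exec (writeTarget M e) (store i r o (params n U V J 0))
      (store i r (zeroWord M e (J + (V + 4)) ++ o) (params n U V J 0))
      (1 + (repCost V 1 + repCost J 1)) := by
  rw [zeroWord_add, zeroWord_add, List.append_assoc, List.append_assoc]
  exact (exec_write _).seq ((exec_writeZeros (k := gap) (by decide) rfl).seq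
    (exec_writeZeros (k := left) (by decide) rfl))

/-- In its use the stack holds the reversed input. As the output grows at its front, popping
restores the order of the letters. -/
theorem exec_writeInput (w : List Γ) (o : List CodeSym) (c : Counter → ℕ) :
    Exec (.loop rev fun a => write (blockWord e (symBlock (M.input a)))) (store i w o c)
      (store i [] (w.reverse.flatMap (fun a => blockWord e (symBlock (M.input a))) ++ o) c)
      (w.length * 2 + 1) := by
  induction w generalizing o with
  | nil => exact Exec.loop_nil rfl
  | cons a w ih =>
    have h1 := exec_write (i := i) (r := w) (o := o) (c := c)
      (blockWord e (symBlock (M.input a)))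
    rw [← update_rev i (a :: w)] at h1
    have h2 := Exec.loop_cons (k := rev)
      (body := fun a => write (blockWord e (symBlock (M.input a))))
      (S := store i (a :: w) o c) rfl h1 (ih _)
    rw [List.reverse_cons, List.flatMap_append, List.append_assoc, List.length_cons]
    simp only [List.flatMap_cons, List.flatMap_nil, List.append_nil]
    exact h2.weaken (by omega)

theorem exec_writeSource (w : List Γ) :
    Exec (writeSource M e) (store i w.reverse o (params n U V J 0))
      (store i [] (sourceWord M e U J w ++ o) (params n U V J 0))
      (repCost J 1 + (1 + (repCost U 1 + ((w.length * 2 + 1) + (1 + (repCost U 1 + 1)))))) := by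
  rw [sourceWord, blankWord_add]
  simp only [List.append_assoc]
  have h := exec_writeInput (i := i) (M := M) (e := e) w.reverse
    (blankWord M e U ++ (blankWord M e 2 ++ (zeroWord M e J ++ o))) (params n U V J 0)
  rw [List.reverse_reverse, List.length_reverse] at h
  exact (exec_writeZeros (k := left) (by decide) rfl).seq ((exec_write _).seq
    ((exec_rep_write (by decide) _ rfl).seq (h.seq ((exec_write _).seq
      ((exec_rep_write (by decide) _ rfl).seq (exec_write _))))))

theorem exec_writeMove (τ : {τ : M.Tile // τ.Valid}) :
    Exec (writeMove M e τ) (store i r o (params n U V x y))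
      (store i r (moveWord e V x y τ ++ o) (params n U V x y))
      (1 + (repCost y 1 + (1 + (repCost V 1 + (1 + (repCost x 1 + 1)))))) := by
  rw [moveWord]
  simp only [List.append_assoc]
  exact (exec_write _).seq ((exec_writeZeros (k := right) (by decide) rfl).seq
    ((exec_write _).seq ((exec_writeZeros (k := gap) (by decide) rfl).seq
    ((exec_write _).seq ((exec_writeZeros (k := left) (by decide) rfl).seq (exec_write _))))))

theorem repCost_mono {a b : ℕ} (h : a ≤ b) : repCost a 1 ≤ repCost b 1 := by
  unfold repCost
  omega

/-- A bound for the time needed to write the rows of the moves of a cell. -/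
def movesCost (t V J : ℕ) : ℕ := t * (repCost J 1 + repCost V 1 + repCost J 1 + 4) + 1

theorem exec_writeMoves (l : List {τ : M.Tile // τ.Valid}) (hx : x ≤ J) (hy : y ≤ J) :
    Exec (writeMoves M e l) (store i r o (params n U V x y))
      (store i r (l.flatMap (moveWord e V x y) ++ o) (params n U V x y))
      (movesCost l.length V J) := by
  induction l with
  | nil => exact (exec_write []).weaken (by simp [movesCost])
  | cons τ l ih =>
    rw [List.flatMap_cons, List.append_assoc]
    refine (ih.seq (exec_writeMove τ)).weaken ?_
    have := repCost_mono hx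
    have := repCost_mono hy
    rw [movesCost, movesCost, List.length_cons, Nat.succ_mul]
    omega

/-- The cells are treated from the last to the first. After each pop, `left` is the index of the
current cell and `right` the number of cells with moves after it: exactly the numbers of zero blocks
at both ends of its rows. -/
theorem exec_countRows (hJ : x + y = J) :
    Exec (count left (.seq (writeMoves M e M.tiles) (incr right 1)))
      (store i r o (params n U V x y))
      (store i r (rowsWord M e V J x ++ o) (params n U V 0 J))
      (x * (movesCost M.tiles.length V J + 2) + 1) := by
  induction x generalizing y o with
  | zero =>
    rw [← hJ, Nat.zero_add]
    exact (Exec.loop_nil rfl).weaken (by omega)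
  | succ x ih =>
    have h1 := (exec_writeMoves (i := i) (r := r) (o := o) (n := n) (U := U) (V := V) (M := M)
      (e := e) M.tiles (show x ≤ J by omega) (show y ≤ J by omega)).seq (exec_incr right 1)
    have e1 : Function.update (params n U V x y) right (params n U V x y right + 1) =
        params n U V x (y + 1) := by
      funext k
      cases k <;> rfl
    have e2 : Function.update (store i r o (params n U V (x + 1) y)) (cnt left)
        (List.replicate x ()) = store i r o (params n U V x y) := by
      rw [update_cnt]
      congr 1
      funext k
      cases k <;> rfl
    rw [e1, ← e2] at h1
    have h2 := Exec.loop_cons (k := cnt left)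
      (body := fun _ => .seq (writeMoves M e M.tiles) (incr right 1))
      (S := store i r o (params n U V (x + 1) y)) (a := ()) rfl h1 (ih (by omega))
    rw [rowsWord, List.range_succ, List.flatMap_append, List.append_assoc]
    simp only [List.flatMap_cons, List.flatMap_nil, List.append_nil]
    rw [show J - 1 - x = y by omega]
    refine h2.weaken ?_
    rw [Nat.succ_mul]
    omega

theorem exec_writeRows :
    Exec (writeRows M e) (store i r o (params n U V J 0))
      (store i r (rowsWord M e V J J ++ o) (params n U V J 0))
      ((J * (movesCost M.tiles.length V J + 2) + 1) + (J * 2 + 1)) := by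
  refine (exec_countRows (Nat.add_zero J)).seq ?_
  convert exec_move (k := right) (k' := left) (by decide) 1 using 2
  · funext k
    cases k <;> simp [params]
  · rfl

theorem exec_clearAll :
    Exec clearAll (store i r o (params n U V J 0)) (store i r o (params 0 0 0 0 0))
      ((n * 2 + 1) + ((U * 2 + 1) + ((V * 2 + 1) + (J * 2 + 1)))) := by
  have h1 := exec_clear (i := i) (r := r) (o := o) (k := len) (c := params n U V J 0)
  have h2 := exec_clear (i := i) (r := r) (o := o) (k := clock) (c := params 0 U V J 0)
  have h3 := exec_clear (i := i) (r := r) (o := o) (k := gap) (c := params 0 0 V J 0)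
  have h4 := exec_clear (i := i) (r := r) (o := o) (k := left) (c := params 0 0 0 J 0)
  have e1 : Function.update (params n U V J 0) len 0 = params 0 U V J 0 := by
    funext k
    cases k <;> rfl
  have e2 : Function.update (params 0 U V J 0) clock 0 = params 0 0 V J 0 := by
    funext k
    cases k <;> rfl
  have e3 : Function.update (params 0 0 V J 0) gap 0 = params 0 0 0 J 0 := by
    funext k
    cases k <;> rfl
  have e4 : Function.update (params 0 0 0 J 0) left 0 = params 0 0 0 0 0 := by
    funext k
    cases k <;> rfl
  rw [e1] at h1
  rw [e2] at h2
  rw [e3] at h3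
  rw [e4] at h4
  exact h1.seq (h2.seq (h3.seq h4))

theorem store_inp (w : List Γ) :
    store w [] [] (params 0 0 0 0 0) = Function.update (fun k => ([] : List (Alph Γ k))) inp w := by
  funext k
  rcases k with _ | _ | _ | k
  · rfl
  · rfl
  · rfl
  · cases k <;> rfl

theorem store_out (o : List CodeSym) :
    store ([] : List Γ) [] o (params 0 0 0 0 0) = Function.update (fun k => ([] : List (Alph Γ k))) out o := by
  funext k
  rcases k with _ | _ | _ | k
  · rfl
  · rfl
  · rfl
  · cases k <;> rfl

/-- The parameters of the reduction are computable in polynomial time. -/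
theorem exists_setup (Γ : Type) (p : Polynomial ℕ) :
    ∃ (P : StackProg (Alph Γ)) (t : ℕ → ℕ), IsPolynomial t ∧ ∀ (w : List Γ) (U V : ℕ),
      U = p.eval w.length + 1 → V = 2 * U + w.length →
        Exec P (store w [] [] (params 0 0 0 0 0))
          (store [] w.reverse [] (params w.length U V (U * (V + 3)) 0)) (t w.length) := by
  obtain ⟨P, q, h⟩ := exists_eval Γ p
  let u : ℕ → ℕ := fun n => p.eval n + 1
  have hu : IsPolynomial u := (IsPolynomial.eval p).add (.const 1)
  have hv : IsPolynomial fun n => 2 * u n + n := ((IsPolynomial.const 2).mul hu).add .id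
  refine ⟨.seq readInput (.seq P computeParams), fun n => (n * 3 + 1) + (q.eval n +
    (1 + (repCost n 1 + (repCost (u n) 1 + repCost (u n) (repCost (2 * u n + n) 1 + 1))))),
    ((IsPolynomial.id.mul (.const 3)).add (.const 1)).add ((IsPolynomial.eval q).add
      ((IsPolynomial.const 1).add ((IsPolynomial.id.repCost (.const 1)).add
        ((hu.repCost (.const 1)).add (hu.repCost ((hv.repCost (.const 1)).add (.const 1))))))),
    fun w U V hU hV => ?_⟩
  have h1 := exec_readInput w [] [] 0
  rw [List.append_nil, Nat.zero_add] at h1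
  have h2 := h [] w.reverse [] (params w.length 0 0 0 0) rfl rfl rfl
  have e1 : Function.update (params w.length 0 0 0 0) clock
      (p.eval (params w.length 0 0 0 0 len)) = params w.length (p.eval w.length) 0 0 0 := by
    funext k
    cases k <;> rfl
  rw [e1] at h2
  have h3 := exec_computeParams [] w.reverse [] w.length U V (p.eval w.length) hU hV
  have := h1.seq (h2.seq h3)
  rw [hV, hU] at this ⊢
  exact this

end StackProg

/-! ## The reductions -/

namespace NTM

variable {Γ : Type} (M : NTM Γ)

/-- The reachability instance of a word. -/
noncomputable def reachInstance (U V : ℕ) (w : List Γ) : ZVASReachInstance where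
  d := numBlocks V U * M.numTokens
  machine := ZVAS.ofVectors (M.dim_pos V U) (M.letters V U)
  source := ZVAS.cfg _ _ (toVec _ (M.initTokens V U w))
  target := ZVAS.cfg _ _ 0

/-- The inclusion instance of a word. The left system has no letters, and starts in the target. -/
noncomputable def inclusionInstance (U V : ℕ) (w : List Γ) : ZVASInclusionInstance where
  d := numBlocks V U * M.numTokens
  left := ZVAS.ofVectors (m := 0) (M.dim_pos V U) fun _ => 0
  leftStart := ZVAS.cfg _ _ 0
  right := ZVAS.ofVectors (M.dim_pos V U) (M.letters V U)
  rightStart := ZVAS.cfg _ _ (toVec _ (M.initTokens V U w))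

variable {M}

theorem reach_of_no_letters {d : ℕ} (hd : 0 < d) (b : Fin 0 → Fin d → ℤ) (v : Fin d → ℤ) :
    (ZVAS.ofVectors hd b).reach (ZVAS.cfg hd b v) = {v} := by
  ext v'
  constructor
  · rintro ⟨q, h⟩
    obtain ⟨n, hn⟩ := ZVAS.exists_count_of_reaches h
    exact hn.trans (by rw [Finset.univ_eq_empty, Finset.sum_empty, add_zero]; rfl)
  · rintro rfl
    exact ⟨(0 : Fin 1), .refl⟩

theorem mem_reach_iff {d m : ℕ} {hd : 0 < d} {b : Fin m → Fin d → ℤ} {v v' : Fin d → ℤ} :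
    v' ∈ (ZVAS.ofVectors hd b).reach (ZVAS.cfg hd b v) ↔
      (ZVAS.ofVectors hd b).Reaches (ZVAS.cfg hd b v) (ZVAS.cfg hd b v') := by
  constructor
  · rintro ⟨q, h⟩
    rwa [ZVAS.config_eq_cfg (_, v')] at h
  · exact fun h => ⟨(0 : Fin 1), h⟩

theorem reachInstance_iff {U V T : ℕ} {w : List Γ} (hU : U = T + 1) (hV : 2 * U ≤ V) :
    ZVASReachability (M.reachInstance U V w) ↔ M.AcceptsIn w T :=
  reaches_iff hU hV

theorem inclusionInstance_iff {U V T : ℕ} {w : List Γ} (hU : U = T + 1) (hV : 2 * U ≤ V) :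
    ZVASInclusion (M.inclusionInstance U V w) ↔ M.AcceptsIn w T := by
  rw [← reaches_iff (M := M) hU hV, ← mem_reach_iff]
  unfold ZVASInclusion inclusionInstance
  rw [reach_of_no_letters, Set.singleton_subset_iff]

/-! ### The words of the complete instances and the programs for them -/

variable (M) in
/-- The word of the reachability instance of a word. -/
noncomputable def reachWord (e : NumberCoding) (U V : ℕ) (w : List Γ) : List CodeSym :=
  rowsWord M e V (U * (V + 3)) (U * (V + 3)) ++ ([CodeSym.bar] ++
    (sourceWord M e U (U * (V + 3)) w ++ ([CodeSym.semicolon] ++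
      (zeroWord M e (U * (V + 3) + (V + 4)) ++ [CodeSym.semicolon, CodeSym.bar]))))

variable (M) in
/-- The word of the inclusion instance of a word. -/
noncomputable def inclusionWord (e : NumberCoding) (U V : ℕ) (w : List Γ) : List CodeSym :=
  [CodeSym.bar] ++ (zeroWord M e (U * (V + 3) + (V + 4)) ++ ([CodeSym.semicolon, CodeSym.bar] ++
    (rowsWord M e V (U * (V + 3)) (U * (V + 3)) ++ ([CodeSym.bar] ++
      (sourceWord M e U (U * (V + 3)) w ++ [CodeSym.semicolon, CodeSym.bar])))))

theorem encode_reachInstance (e : NumberCoding) {U V : ℕ} {w : List Γ}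
    (hV : V = 2 * U + w.length) :
    (ZVASReachInstance.encoding e).encode (M.reachInstance U V w) = reachWord M e U V w := by
  have h : (ZVASReachInstance.encoding e).encode (M.reachInstance U V w) =
      e.encodeBlocks [(ZVAS.ofVectors (M.dim_pos V U) (M.letters V U)).rows,
        [List.ofFn (toVec (numBlocks V U) (M.initTokens V U w)),
          List.ofFn (0 : Fin (numBlocks V U * M.numTokens) → ℤ)]] := rfl
  rw [h, NumberCoding.encodeBlocks]
  simp only [List.flatMap_cons, List.flatMap_nil, encodeBlock_rows]
  rw [NumberCoding.encodeBlock]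
  simp only [List.flatMap_cons, List.flatMap_nil, encodeRow_initTokens e hV, encodeRow_zero]
  simp [reachWord, numBlocks]

theorem encode_inclusionInstance (e : NumberCoding) {U V : ℕ} {w : List Γ}
    (hV : V = 2 * U + w.length) :
    (ZVASInclusionInstance.encoding e).encode (M.inclusionInstance U V w) =
      inclusionWord M e U V w := by
  have h : (ZVASInclusionInstance.encoding e).encode (M.inclusionInstance U V w) =
      e.encodeBlocks [(ZVAS.ofVectors (m := 0) (M.dim_pos V U) fun _ => 0).rows,
        [List.ofFn (0 : Fin (numBlocks V U * M.numTokens) → ℤ)],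
        (ZVAS.ofVectors (M.dim_pos V U) (M.letters V U)).rows,
        [List.ofFn (toVec (numBlocks V U) (M.initTokens V U w))]] := rfl
  have h0 : (ZVAS.ofVectors (m := 0) (M.dim_pos V U) fun _ => 0).rows = [] := by
    rw [ZVAS.rows_ofVectors, List.ofFn_zero]
  rw [h, h0, NumberCoding.encodeBlocks]
  simp only [List.flatMap_cons, List.flatMap_nil, encodeBlock_rows]
  simp only [NumberCoding.encodeBlock, List.flatMap_cons, List.flatMap_nil,
    encodeRow_initTokens e hV, encodeRow_zero]
  simp [inclusionWord, numBlocks]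

open StackProg in
theorem exists_writeInstances (M : NTM Γ) (e : NumberCoding) (p : Polynomial ℕ) :
    (∃ (P : StackProg (Alph Γ)) (q : Polynomial ℕ), ∀ (w : List Γ) (U V : ℕ),
      U = p.eval w.length + 1 → V = 2 * U + w.length →
        Exec P (store w [] [] (params 0 0 0 0 0))
          (store [] [] (reachWord M e U V w) (params 0 0 0 0 0)) (q.eval w.length)) ∧
    ∃ (P : StackProg (Alph Γ)) (q : Polynomial ℕ), ∀ (w : List Γ) (U V : ℕ),
      U = p.eval w.length + 1 → V = 2 * U + w.length →
        Exec P (store w [] [] (params 0 0 0 0 0))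
          (store [] [] (inclusionWord M e U V w) (params 0 0 0 0 0)) (q.eval w.length) := by
  obtain ⟨P, t, ht, hP⟩ := exists_setup Γ p
  let u : ℕ → ℕ := fun n => p.eval n + 1
  let v : ℕ → ℕ := fun n => 2 * u n + n
  let J : ℕ → ℕ := fun n => u n * (v n + 3)
  have hu : IsPolynomial u := (IsPolynomial.eval p).add (.const 1)
  have hv : IsPolynomial v := ((IsPolynomial.const 2).mul hu).add .id
  have hJ : IsPolynomial J := hu.mul (hv.add (.const 3))
  let t₁ : ℕ → ℕ := fun n => 1 + (repCost (v n) 1 + repCost (J n) 1)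
  have ht₁ : IsPolynomial t₁ :=
    (IsPolynomial.const 1).add ((hv.repCost (.const 1)).add (hJ.repCost (.const 1)))
  let t₂ : ℕ → ℕ := fun n => repCost (J n) 1 + (1 + (repCost (u n) 1 + ((n * 2 + 1) +
    (1 + (repCost (u n) 1 + 1)))))
  have ht₂ : IsPolynomial t₂ :=
    (hJ.repCost (.const 1)).add ((IsPolynomial.const 1).add ((hu.repCost (.const 1)).add
      (((IsPolynomial.id.mul (.const 2)).add (.const 1)).add ((IsPolynomial.const 1).add
        ((hu.repCost (.const 1)).add (.const 1))))))
  let t₃ : ℕ → ℕ := fun n => (J n * (movesCost M.tiles.length (v n) (J n) + 2) + 1) +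
    (J n * 2 + 1)
  have ht₃ : IsPolynomial t₃ :=
    ((hJ.mul ((((IsPolynomial.const M.tiles.length).mul ((((hJ.repCost (.const 1)).add
      (hv.repCost (.const 1))).add (hJ.repCost (.const 1))).add (.const 4))).add
        (.const 1)).add (.const 2))).add (.const 1)).add ((hJ.mul (.const 2)).add (.const 1))
  let t₄ : ℕ → ℕ := fun n => (n * 2 + 1) + ((u n * 2 + 1) + ((v n * 2 + 1) + (J n * 2 + 1)))
  have lin : ∀ {f : ℕ → ℕ}, IsPolynomial f → IsPolynomial fun n => f n * 2 + 1 :=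
    fun hf => (hf.mul (.const 2)).add (.const 1)
  have ht₄ : IsPolynomial t₄ := (lin .id).add ((lin hu).add ((lin hv).add (lin hJ)))
  constructor
  · obtain ⟨q, hq⟩ := ht.add ((IsPolynomial.const 1).add (ht₁.add ((IsPolynomial.const 1).add
      (ht₂.add ((IsPolynomial.const 1).add (ht₃.add ht₄))))))
    -- The parts of the word are written from the last to the first, because output is added in
    -- front.
    refine ⟨.seq P (.seq (write [CodeSym.semicolon, CodeSym.bar]) (.seq (writeTarget M e)
      (.seq (write [CodeSym.semicolon]) (.seq (writeSource M e) (.seq (write [CodeSym.bar])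
        (.seq (writeRows M e) clearAll)))))), q, fun w U V hU hV => ?_⟩
    rw [← hq]
    have h := hP w U V hU hV
    subst hV hU
    exact h.seq ((exec_write _).seq (exec_writeTarget.seq ((exec_write _).seq
      ((exec_writeSource w).seq ((exec_write _).seq (exec_writeRows.seq exec_clearAll))))))
  · obtain ⟨q, hq⟩ := ht.add ((IsPolynomial.const 1).add (ht₂.add ((IsPolynomial.const 1).add
      (ht₃.add ((IsPolynomial.const 1).add (ht₁.add ((IsPolynomial.const 1).add ht₄)))))))
    refine ⟨.seq P (.seq (write [CodeSym.semicolon, CodeSym.bar]) (.seq (writeSource M e)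
      (.seq (write [CodeSym.bar]) (.seq (writeRows M e)
        (.seq (write [CodeSym.semicolon, CodeSym.bar]) (.seq (writeTarget M e)
          (.seq (write [CodeSym.bar]) clearAll))))))), q, fun w U V hU hV => ?_⟩
    rw [← hq]
    have h := hP w U V hU hV
    subst hV hU
    exact h.seq ((exec_write _).seq ((exec_writeSource w).seq ((exec_write _).seq
      (exec_writeRows.seq ((exec_write _).seq (exec_writeTarget.seq ((exec_write _).seq
        exec_clearAll)))))))

end NTM

open StackProg NTM in
/-- A problem is hard for NP if every nondeterministic machine with a polynomial time bound can be
translated into instances whose words are written by a program in polynomial time. -/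
theorem npHard_of_program {I : Type} {enc : Computability.Encoding I CodeSym} {Yes : I → Prop}
    (inst : ∀ {Γ : Type}, NTM Γ → ℕ → ℕ → List Γ → I)
    (hinst : ∀ {Γ : Type} {M : NTM Γ} {U V T : ℕ} {w : List Γ}, U = T + 1 → 2 * U ≤ V →
      (Yes (inst M U V w) ↔ M.AcceptsIn w T))
    (hprog : ∀ {Γ : Type} (M : NTM Γ) (p : Polynomial ℕ),
      ∃ (P : StackProg (Alph Γ)) (q : Polynomial ℕ), ∀ (w : List Γ) (U V : ℕ),
        U = p.eval w.length + 1 → V = 2 * U + w.length →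
          Exec P (store w [] [] (params 0 0 0 0 0))
            (store [] [] (enc.encode (inst M U V w)) (params 0 0 0 0 0)) (q.eval w.length)) :
    NPHard enc Yes := by
  intro Γ _ L ⟨M, p, hL⟩
  obtain ⟨P, q, hP⟩ := hprog M p
  let f : List Γ → I := fun w =>
    -- One row more than the time bound lets a head at time `T` still use an accepting move; the
    -- width leaves at least `U` blank cells on each side of the input.
    inst M (p.eval w.length + 1) (2 * (p.eval w.length + 1) + w.length) w
  refine ⟨f, ?_, fun w => (hL w).trans (hinst rfl (by omega)).symm⟩
  refine computableInPolyTime (A := Alph Γ) P .inp .out enc.encode f q fun (w : List Γ) => ?_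
  have h := hP w _ _ rfl rfl
  rw [store_inp, store_out] at h
  exact h

theorem mainTheorem6 (e : NumberCoding) :
    NPHard (ZVASReachInstance.encoding e) ZVASReachability ∧
      NPHard (ZVASInclusionInstance.encoding e) ZVASInclusion := by
  constructor
  · refine npHard_of_program (fun M => M.reachInstance) NTM.reachInstance_iff fun M p => ?_
    obtain ⟨P, q, h⟩ := (NTM.exists_writeInstances M e p).1
    exact ⟨P, q, fun w U V hU hV => by
      rw [NTM.encode_reachInstance e hV]
      exact h w U V hU hV⟩
  · refine npHard_of_program (fun M => M.inclusionInstance) NTM.inclusionInstance_iff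
      fun M p => ?_
    obtain ⟨P, q, h⟩ := (NTM.exists_writeInstances M e p).2
    exact ⟨P, q, fun w U V hU hV => by
      rw [NTM.encode_inclusionInstance e hV]
      exact h w U V hU hV⟩
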